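/- Let $\Omega=(0,1)^2$ and, for $n\ge 1$, let $\mathcal T_n$ be the Friedrichs–Keller triangulation of $\overline\Omega$: the square is divided into $n\times n$ congruent squares of side $1/n$, and each of them is cut into two triangles by the diagonal joining its upper left and its lower right corner. Let $V_n$ be the space of continuous functions on $\overline\Omega$ that are polynomials of degree at most $3$ on every triangle of $\mathcal T_n$ and vanish on $\partial\Omega$, let $\varphi_i$ be its Lagrangian nodal basis with respect to the $(3n-1)^2$ internal nodes $\left(\tfrac{i_1}{3n},\tfrac{i_2}{3n}\right)$, $1\le i_1,i_2\le 3n-1$, and let $A_n(1,\Omega,\mathbb P_3)=\left[\int_\Omega\nabla\varphi_j\cdot\nabla\varphi_i\right]_{i,j}$ be the stiffness matrix. Let $\mathbf f_{\mathbb P_3}:[-\pi,\pi]^2\to\mathbb C^{9\times 9}$ be the Hermitian matrix-valued function which, with $e_k=\mathrm e^{\hat\imath\theta_k}$, is $$\mathbf f_{\mathbb P_3}(\theta_1,\theta_2)=\begin{bmatrix} \alpha&-\frac\alpha4&-\frac\alpha4e_1&-\frac\alpha4&0&0&-\frac\alpha4e_2&0&0\\ -\frac\alpha4&\beta&-\frac\beta4+\frac\beta{20}e_1&-\frac\beta5&-\frac\alpha4&\frac\beta{20}(1+e_1)&\frac\beta{20}(1+e_2)&\frac\beta{20}-\frac\beta4e_2&f_{29}\\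 -\frac\alpha4\overline{e_1}&-\frac\beta4+\frac\beta{20}\overline{e_1}&\beta&\frac\beta{20}(1+\overline{e_1})&0&-\frac\beta2&0&0&f_{39}\\ -\frac\alpha4&-\frac\beta5&\frac\beta{20}(1+e_1)&\beta&-\frac\alpha4&\frac\beta{20}-\frac\beta4e_1&-\frac\beta4+\frac\beta{20}e_2&\frac\beta{20}(1+e_2)&f_{49}\\ 0&-\frac\alpha4&0&-\frac\alpha4&\alpha&-\frac\alpha4&0&-\frac\alpha4&0\\ 0&\frac\beta{20}(1+\overline{e_1})&-\frac\beta2&\frac\beta{20}-\frac\beta4\overline{e_1}&-\frac\alpha4&\beta&0&0&f_{69}\\ -\frac\alpha4\overline{e_2}&\frac\beta{20}(1+\overline{e_2})&0&-\frac\beta4+\frac\beta{20}\overline{e_2}&0&0&\beta&-\frac\beta2&f_{79}\\ 0&\frac\beta{20}-\frac\beta4\overline{e_2}&0&\frac\beta{20}(1+\overline{e_2})&-\frac\alpha4&0&-\frac\beta2&\beta&f_{89}\\ 0&\overline{f_{29}}&\overline{f_{39}}&\overline{f_{49}}&0&\overline{f_{69}}&\overline{f_{79}}&\overline{f_{89}}&f_{99}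 \end{bmatrix},$$ where $f_{29}=f_{49}=-\gamma(1-e_1)(1-e_2)$, $f_{39}=\delta-\frac\gamma2e_1-\varepsilon e_2-\frac\gamma2\overline{e_1}e_2$, $f_{69}=-\varepsilon-\frac\gamma2e_1+\delta e_2-\frac\gamma2\overline{e_1}e_2$, $f_{79}=\delta-\varepsilon e_1-\frac\gamma2e_1\overline{e_2}-\frac\gamma2e_2$, $f_{89}=-\varepsilon+\delta e_1-\frac\gamma2e_1\overline{e_2}-\frac\gamma2e_2$, $f_{99}=\zeta-2\eta(\cos\theta_1+\cos\theta_2)$, and $\alpha=\frac{81}{10}$, $\beta=\frac{27}4$, $\gamma=\frac3{40}$, $\delta=\frac{57}{80}$, $\varepsilon=\frac{21}{16}$, $\zeta=\frac{17}5$, $\eta=\frac7{40}$. Let $T_n(\mathbf f_{\mathbb P_3})=[\hat{\mathbf f}_{\mathbf i-\mathbf j}]_{\mathbf i,\mathbf j\in\{1,\dots,n\}^2}\in\mathbb C^{9n^2\times 9n^2}$ be the two-level block Toeplitz matrix with blocks $\hat{\mathbf f}_{\mathbf k}=\frac1{(2\pi)^2}\int_{[-\pi,\pi]^2}\mathbf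 f_{\mathbb P_3}(\boldsymbol\theta)\,\mathrm e^{-\hat\imath(k_1\theta_1+k_2\theta_2)}\,\mathrm d\boldsymbol\theta$. Let the range $\mathcal R$ of $\mathbf f_{\mathbb P_3}$ be the union of the ranges of its eigenvalue functions, that is, the set of all eigenvalues of the matrices $\mathbf f_{\mathbb P_3}(\boldsymbol\theta)$, $\boldsymbol\theta\in[-\pi,\pi]^2$. Then $\mathcal R$ is a weak cluster set for the spectra of $\{T_n(\mathbf f_{\mathbb P_3})\}_n$ and of $\{A_n(1,\Omega,\mathbb P_3)\}_n$: $\mathcal R$ is nonempty and closed, and for each of these two sequences and every $\epsilon>0$ the number of eigenvalues (counted with multiplicity) of the $n$-th matrix outside $\bigcup_{z\in\mathcal R}\{w\in\mathbb C:|w-z|<\epsilon\}$ is $o(d_n)$ as $n\to\infty$, where $d_n$ is the size of the $n$-th matrix, which increases with $n$. Moreover, for every $n$, all the eigenvalues of $T_n(\mathbf f_{\mathbb P_3})$ and of $A_n(1,\Omega,\mathbb P_3)$ lie in the convex hull of $\mathcal R$. -/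

import Mathlib

open MeasureTheory Filter Asymptotics Set

namespace P3FEM

/-! ### Spectra, clustering, multilevel block Toeplitz matrices -/

/-- The number of eigenvalues of `A`, counted with algebraic multiplicity, that lie outside the
`ε`-expansion `⋃ z ∈ S, B(z, ε)` of `S`. -/
noncomputable def numOutliers {ι : Type*} [Fintype ι] [DecidableEq ι]
    (A : Matrix ι ι ℂ) (S : Set ℂ) (ε : ℝ) : ℕ := by
  classical
  exact (A.charpoly.roots.filter (fun z => z ∉ ⋃ w ∈ S, Metric.ball w ε)).card

/-- A sequence of matrices of increasing sizes `d n` is weakly clustered at the nonempty closed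
set `S` (in the sense of the eigenvalues): for every `ε > 0` the number of eigenvalues outside the
`ε`-expansion of `S` is `o(d n)`. -/
structure IsWeaklyClustered {ι : ℕ → Type*} [∀ n, Fintype (ι n)] [∀ n, DecidableEq (ι n)]
    (A : ∀ n, Matrix (ι n) (ι n) ℂ) (S : Set ℂ) : Prop where
  nonempty : S.Nonempty
  isClosed : IsClosed S
  size_strictMono : StrictMono fun n => Fintype.card (ι n)
  outliers_isLittleO : ∀ ε : ℝ, 0 < ε →
    (fun n => (numOutliers (A n) S ε : ℝ)) =o[atTop] fun n => (Fintype.card (ι n) : ℝ)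

/-- The Fourier coefficient with index `(k, l)` of a matrix-valued function on `[-π, π]²`,
computed entrywise. -/
noncomputable def fourierCoeff {r : ℕ} (f : ℝ → ℝ → Matrix (Fin r) (Fin r) ℂ) (k l : ℤ) :
    Matrix (Fin r) (Fin r) ℂ :=
  Matrix.of fun a b => (1 / (2 * (Real.pi : ℂ)) ^ 2) *
    ∫ θ in Icc (-Real.pi) Real.pi ×ˢ Icc (-Real.pi) Real.pi,
      f θ.1 θ.2 a b * Complex.exp (-Complex.I * ((k : ℂ) * (θ.1 : ℂ) + (l : ℂ) * (θ.2 : ℂ)))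

/-- The two-level block Toeplitz matrix `T_(n₁, n₂)(f) = [f̂_(i - j)]` generated by `f`; a row or
column index is a pair of a multi-index and a position inside the block. -/
noncomputable def toeplitz {r : ℕ} (f : ℝ → ℝ → Matrix (Fin r) (Fin r) ℂ) (n₁ n₂ : ℕ) :
    Matrix ((Fin n₁ × Fin n₂) × Fin r) ((Fin n₁ × Fin n₂) × Fin r) ℂ :=
  Matrix.of fun i j =>
    fourierCoeff f ((i.1.1 : ℤ) - (j.1.1 : ℤ)) ((i.1.2 : ℤ) - (j.1.2 : ℤ)) i.2 j.2

/-- The range of a matrix-valued function on `[-π, π]²`: the set of all eigenvalues of its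
values, that is, the union of the ranges of its eigenvalue functions. -/
def symbolRange {r : ℕ} (f : ℝ → ℝ → Matrix (Fin r) (Fin r) ℂ) : Set ℂ :=
  {z | ∃ θ₁ ∈ Icc (-Real.pi) Real.pi, ∃ θ₂ ∈ Icc (-Real.pi) Real.pi, z ∈ spectrum ℂ (f θ₁ θ₂)}

/-! ### The symbol of the cubic elements -/

/-- The `9 × 9` matrix-valued symbol of the cubic Lagrangian elements on the unit square. -/
noncomputable def symbolP3 (θ₁ θ₂ : ℝ) : Matrix (Fin 9) (Fin 9) ℂ :=
  let α : ℂ := 81 / 10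
  let β : ℂ := 27 / 4
  let γ : ℂ := 3 / 40
  let δ : ℂ := 57 / 80
  let ε : ℂ := 21 / 16
  let ζ : ℂ := 17 / 5
  let η : ℂ := 7 / 40
  let e₁ : ℂ := Complex.exp (Complex.I * θ₁)
  let e₂ : ℂ := Complex.exp (Complex.I * θ₂)
  let c₁ : ℂ := Complex.exp (-(Complex.I * θ₁))
  let c₂ : ℂ := Complex.exp (-(Complex.I * θ₂))
  let f₂₉ : ℂ := -γ * (1 - e₁) * (1 - e₂)
  let f₃₉ : ℂ := δ - γ / 2 * e₁ - ε * e₂ - γ / 2 * c₁ * e₂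
  let f₄₉ : ℂ := -γ * (1 - e₁) * (1 - e₂)
  let f₆₉ : ℂ := -ε - γ / 2 * e₁ + δ * e₂ - γ / 2 * c₁ * e₂
  let f₇₉ : ℂ := δ - ε * e₁ - γ / 2 * e₁ * c₂ - γ / 2 * e₂
  let f₈₉ : ℂ := -ε + δ * e₁ - γ / 2 * e₁ * c₂ - γ / 2 * e₂
  let f₉₉ : ℂ := ζ - 2 * η * (Real.cos θ₁ + Real.cos θ₂)
  !![α, -α / 4, -α / 4 * e₁, -α / 4, 0, 0, -α / 4 * e₂, 0, 0;
     -α / 4, β, -β / 4 + β / 20 * e₁, -β / 5, -α / 4, β / 20 * (1 + e₁), β / 20 * (1 + e₂),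
       β / 20 - β / 4 * e₂, f₂₉;
     -α / 4 * c₁, -β / 4 + β / 20 * c₁, β, β / 20 * (1 + c₁), 0, -β / 2, 0, 0, f₃₉;
     -α / 4, -β / 5, β / 20 * (1 + e₁), β, -α / 4, β / 20 - β / 4 * e₁, -β / 4 + β / 20 * e₂,
       β / 20 * (1 + e₂), f₄₉;
     0, -α / 4, 0, -α / 4, α, -α / 4, 0, -α / 4, 0;
     0, β / 20 * (1 + c₁), -β / 2, β / 20 - β / 4 * c₁, -α / 4, β, 0, 0, f₆₉;
     -α / 4 * c₂, β / 20 * (1 + c₂), 0, -β / 4 + β / 20 * c₂, 0, 0, β, -β / 2, f₇₉;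
     0, β / 20 - β / 4 * c₂, 0, β / 20 * (1 + c₂), -α / 4, 0, -β / 2, β, f₈₉;
     0, star f₂₉, star f₃₉, star f₄₉, 0, star f₆₉, star f₇₉, star f₈₉, f₉₉]

/-! ### Cubic Lagrangian elements on the Friedrichs-Keller triangulation of the unit square

The closed unit square is cut into `n × n` squares of side `1 / n`, and every one of them into two
triangles by the diagonal that joins its upper left and its lower right corner. -/

/-- The domain `Ω = (0, 1)²`. -/
def unitSquare : Set (ℝ × ℝ) := Ioo 0 1 ×ˢ Ioo 0 1

/-- The triangle with vertices `(a, b) / n`, `(a + 1, b) / n`, `(a, b + 1) / n`. -/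
def lowerTriangle (n a b : ℕ) : Set (ℝ × ℝ) :=
  {z | (a : ℝ) ≤ n * z.1 ∧ (b : ℝ) ≤ n * z.2 ∧ n * z.1 + n * z.2 ≤ a + b + 1}

/-- The triangle with vertices `(a + 1, b + 1) / n`, `(a, b + 1) / n`, `(a + 1, b) / n`. -/
def upperTriangle (n a b : ℕ) : Set (ℝ × ℝ) :=
  {z | n * z.1 ≤ (a : ℝ) + 1 ∧ n * z.2 ≤ (b : ℝ) + 1 ∧ (a : ℝ) + b + 1 ≤ n * z.1 + n * z.2}

/-- `φ` is given by a polynomial of total degree at most `3` on `K`. -/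
def IsCubicOn (φ : ℝ × ℝ → ℝ) (K : Set (ℝ × ℝ)) : Prop :=
  ∃ P : MvPolynomial (Fin 2) ℝ, P.totalDegree ≤ 3 ∧
    ∀ z ∈ K, φ z = MvPolynomial.eval ![z.1, z.2] P

/-- `φ` (restricted to the closed square) lies in the finite element space `V_h`: it is continuous
on the closed square, a polynomial of degree at most three on every triangle, and zero on the
boundary. -/
structure IsP3Function (n : ℕ) (φ : ℝ × ℝ → ℝ) : Prop where
  continuousOn : ContinuousOn φ (closure unitSquare)
  cubic_lower : ∀ a < n, ∀ b < n, IsCubicOn φ (lowerTriangle n a b)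
  cubic_upper : ∀ a < n, ∀ b < n, IsCubicOn φ (upperTriangle n a b)
  boundary : ∀ z ∈ frontier unitSquare, φ z = 0

/-- The piecewise linear hat function at the origin, for the triangulation with mesh size `1`. -/
noncomputable def hat (s t : ℝ) : ℝ := max 0 (1 - max |s| (max |t| |s + t|))

/-- The barycentric coordinate function of the vertex `v / n`: the continuous piecewise linear
function that is `1` at this vertex and `0` at all other vertices. -/
noncomputable def bary (n : ℕ) (v : ℕ × ℕ) (z : ℝ × ℝ) : ℝ := hat (n * z.1 - v.1) (n * z.2 - v.2)

/-- The node with grid coordinates `m`. -/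
noncomputable def node (n : ℕ) (m : ℕ × ℕ) : ℝ × ℝ := ((m.1 : ℝ) / (3 * n), (m.2 : ℝ) / (3 * n))

/-- Three times the barycentric coordinate at the vertex `v` of the node with grid
coordinates `m`. -/
def nodeDegree (m v : ℕ × ℕ) : ℕ :=
  (3 - max |(m.1 : ℤ) - 3 * v.1| (max |(m.2 : ℤ) - 3 * v.2|
    |((m.1 : ℤ) - 3 * v.1) + ((m.2 : ℤ) - 3 * v.2)|)).toNat

/-- The univariate polynomial of degree `k` that vanishes at `j / 3` for `j < k` and equals `1`
at `k / 3`. -/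
noncomputable def lagrangeFactor (k : ℕ) (t : ℝ) : ℝ := ∏ j ∈ Finset.range k, (3 * t - j) / (j + 1)

/-- The Lagrangian basis function of the node with grid coordinates `m`, written in barycentric
coordinates. -/
noncomputable def basisFun (n : ℕ) (m : ℕ × ℕ) (z : ℝ × ℝ) : ℝ :=
  ∏ v ∈ Finset.range (n + 1) ×ˢ Finset.range (n + 1),
    lagrangeFactor (nodeDegree m v) (bary n v z)

/-- The grid coordinates of the internal node with index `i`; they run through
`{1, …, 3 n - 1}²`. -/
def internalNode (n : ℕ) (i : Fin (3 * n - 1) × Fin (3 * n - 1)) : ℕ × ℕ :=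
  ((i.1 : ℕ) + 1, (i.2 : ℕ) + 1)

/-- The scalar product of the gradients of `φ` and `ψ` at `z`. -/
noncomputable def gradDot (φ ψ : ℝ × ℝ → ℝ) (z : ℝ × ℝ) : ℝ :=
  fderiv ℝ φ z (1, 0) * fderiv ℝ ψ z (1, 0) + fderiv ℝ φ z (0, 1) * fderiv ℝ ψ z (0, 1)

/-- The stiffness matrix `A_n(a, Ω, ℙ₃)`, with entries `∫_Ω a ∇φ_j · ∇φ_i`, where `φ_i` is the basis
function of the `i`-th internal node. The gradients exist outside the edges of the triangulation,
hence almost everywhere. -/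
noncomputable def stiffness (a : ℝ × ℝ → ℝ) (n : ℕ) :
    Matrix (Fin (3 * n - 1) × Fin (3 * n - 1)) (Fin (3 * n - 1) × Fin (3 * n - 1)) ℝ :=
  Matrix.of fun i j => ∫ z in unitSquare,
    a z * gradDot (basisFun n (internalNode n j)) (basisFun n (internalNode n i)) z

/-! ### The basis functions lie in the finite element space and are nodal -/

theorem lagrangeFactor_zero {k : ℕ} (hk : k ≠ 0) : lagrangeFactor k 0 = 0 := by
  unfold lagrangeFactor
  exact Finset.prod_eq_zero (Finset.mem_range.2 (Nat.pos_of_ne_zero hk)) (by simp)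

theorem lagrangeFactor_eq_choose (k j : ℕ) : lagrangeFactor k ((j : ℝ) / 3) = (j.choose k : ℝ) := by
  induction k with
  | zero => simp [lagrangeFactor]
  | succ k ih =>
    have h : lagrangeFactor (k + 1) ((j : ℝ) / 3)
        = lagrangeFactor k ((j : ℝ) / 3) * ((3 * ((j : ℝ) / 3) - k) / (k + 1)) :=
      Finset.prod_range_succ _ _
    rw [h, ih]
    have h2 : ((j.choose (k + 1) : ℕ) : ℝ) * (k + 1) = (j.choose k : ℝ) * (j - k) := by
      rcases le_or_gt k j with hkj | hkj
      · have := Nat.choose_succ_right_eq j k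
        have h3 : ((j.choose (k + 1) * (k + 1) : ℕ) : ℝ) = ((j.choose k * (j - k) : ℕ) : ℝ) := by
          rw [this]
        push_cast [Nat.cast_sub hkj] at h3
        exact h3
      · rw [Nat.choose_eq_zero_of_lt hkj, Nat.choose_eq_zero_of_lt (by omega)]; simp
    have h4 : (k : ℝ) + 1 ≠ 0 := by positivity
    field_simp
    linarith

theorem hat_neg (s t : ℝ) : hat (-s) (-t) = hat s t := by
  have : -s + -t = -(s + t) := by ring
  simp only [hat, this, abs_neg]

theorem hat_zero_of_left {s t : ℝ} (h : 1 ≤ |s|) : hat s t = 0 := by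
  have := le_max_left |s| (max |t| |s + t|)
  exact max_eq_left (by linarith)

theorem hat_zero_of_right {s t : ℝ} (h : 1 ≤ |t|) : hat s t = 0 := by
  have := le_max_right |s| (max |t| |s + t|)
  have := le_max_left |t| |s + t|
  exact max_eq_left (by linarith)

theorem hat_zero_of_add {s t : ℝ} (h : 1 ≤ |s + t|) : hat s t = 0 := by
  have := le_max_right |s| (max |t| |s + t|)
  have := le_max_right |t| |s + t|
  exact max_eq_left (by linarith)

theorem hat_origin {s t : ℝ} (hs : 0 ≤ s) (ht : 0 ≤ t) (hst : s + t ≤ 1) :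
    hat s t = 1 - s - t := by
  rw [hat, abs_of_nonneg hs, abs_of_nonneg ht, abs_of_nonneg (by linarith),
    max_eq_right (a := t) (by linarith), max_eq_right (a := s) (by linarith),
    max_eq_right (by linarith)]
  ring

theorem hat_left {s t : ℝ} (hs : 0 ≤ s) (ht : 0 ≤ t) (hst : s + t ≤ 1) :
    hat (s - 1) t = s := by
  rw [hat, abs_of_nonpos (by linarith : s - 1 ≤ 0), abs_of_nonneg ht,
    abs_of_nonpos (by linarith : s - 1 + t ≤ 0), max_eq_left (a := -(s - 1))
      (max_le (by linarith) (by linarith)), max_eq_right (by linarith)]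
  ring

theorem hat_right {s t : ℝ} (hs : 0 ≤ s) (ht : 0 ≤ t) (hst : s + t ≤ 1) :
    hat s (t - 1) = t := by
  rw [hat, abs_of_nonpos (by linarith : t - 1 ≤ 0), abs_of_nonneg hs,
    abs_of_nonpos (by linarith : s + (t - 1) ≤ 0), max_eq_left (a := -(t - 1)) (by linarith),
    max_eq_right (a := s) (by linarith), max_eq_right (by linarith)]
  ring

theorem hat_shift_zero {s t : ℝ} (hs : 0 ≤ s) (ht : 0 ≤ t) (hst : s + t ≤ 1) {i j : ℤ}
    (h0 : ¬ (i = 0 ∧ j = 0)) (h1 : ¬ (i = -1 ∧ j = 0)) (h2 : ¬ (i = 0 ∧ j = -1)) :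
    hat (s + i) (t + j) = 0 := by
  by_cases hi : 1 ≤ i
  · have : (1 : ℝ) ≤ i := by exact_mod_cast hi
    exact hat_zero_of_left (le_abs.2 (Or.inl (by linarith)))
  by_cases hi' : i ≤ -2
  · have : (i : ℝ) ≤ -2 := by exact_mod_cast hi'
    exact hat_zero_of_left (le_abs.2 (Or.inr (by linarith)))
  by_cases hj : 1 ≤ j
  · have : (1 : ℝ) ≤ j := by exact_mod_cast hj
    exact hat_zero_of_right (le_abs.2 (Or.inl (by linarith)))
  by_cases hj' : j ≤ -2
  · have : (j : ℝ) ≤ -2 := by exact_mod_cast hj'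
    exact hat_zero_of_right (le_abs.2 (Or.inr (by linarith)))
  have hi1 : i = -1 := by omega
  have hj1 : j = -1 := by omega
  subst hi1 hj1
  exact hat_zero_of_add (le_abs.2 (Or.inr (by push_cast; linarith)))

/-- If every vertex off the triangle `u, v, w` has degree zero at the node, the basis function is
the product of the three factors of the triangle. -/
theorem basisFun_eq_three {n : ℕ} {m u v w : ℕ × ℕ} (z : ℝ × ℝ)
    (hu : u.1 ≤ n ∧ u.2 ≤ n) (hv : v.1 ≤ n ∧ v.2 ≤ n) (hw : w.1 ≤ n ∧ w.2 ≤ n)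
    (huv : u ≠ v) (huw : u ≠ w) (hvw : v ≠ w)
    (h : ∀ x : ℕ × ℕ, x ≠ u → x ≠ v → x ≠ w → nodeDegree m x = 0) :
    basisFun n m z = lagrangeFactor (nodeDegree m u) (bary n u z) *
      lagrangeFactor (nodeDegree m v) (bary n v z) *
      lagrangeFactor (nodeDegree m w) (bary n w z) := by
  unfold basisFun
  rw [← Finset.prod_subset (s₁ := {u, v, w})]
  · rw [Finset.prod_insert (by simp [huv, huw]), Finset.prod_insert (by simp [hvw]),
      Finset.prod_singleton, mul_assoc]
  · intro x hx
    simp only [Finset.mem_insert, Finset.mem_singleton] at hx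
    simp only [Finset.mem_product, Finset.mem_range]
    rcases hx with rfl | rfl | rfl <;> omega
  · intro x _ hx
    simp only [Finset.mem_insert, Finset.mem_singleton, not_or] at hx
    rw [h x hx.1 hx.2.1 hx.2.2]
    simp [lagrangeFactor]

theorem basisFun_eq_zero {n : ℕ} {m v : ℕ × ℕ} {z : ℝ × ℝ} (hv : v.1 ≤ n ∧ v.2 ≤ n)
    (hd : nodeDegree m v ≠ 0) (hb : bary n v z = 0) : basisFun n m z = 0 := by
  unfold basisFun
  refine Finset.prod_eq_zero (i := v) ?_ ?_
  · simp only [Finset.mem_product, Finset.mem_range]; omega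
  · rw [hb, lagrangeFactor_zero hd]

theorem bary_lower_zero {n a b : ℕ} {v : ℕ × ℕ} {z : ℝ × ℝ} (hz : z ∈ lowerTriangle n a b)
    (h0 : v ≠ (a, b)) (h1 : v ≠ (a + 1, b)) (h2 : v ≠ (a, b + 1)) : bary n v z = 0 := by
  obtain ⟨ha, hb, hab⟩ := hz
  have := hat_shift_zero (s := n * z.1 - a) (t := n * z.2 - b) (i := (a : ℤ) - v.1)
    (j := (b : ℤ) - v.2) (by linarith) (by linarith) (by linarith)
    (fun h => h0 (Prod.ext (by simp; omega) (by simp; omega)))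
    (fun h => h1 (Prod.ext (by simp; omega) (by simp; omega)))
    (fun h => h2 (Prod.ext (by simp; omega) (by simp; omega)))
  rw [bary, ← this]
  push_cast
  congr 1 <;> ring

theorem bary_upper_zero {n a b : ℕ} {v : ℕ × ℕ} {z : ℝ × ℝ} (hz : z ∈ upperTriangle n a b)
    (h0 : v ≠ (a + 1, b + 1)) (h1 : v ≠ (a, b + 1)) (h2 : v ≠ (a + 1, b)) : bary n v z = 0 := by
  obtain ⟨ha, hb, hab⟩ := hz
  have := hat_shift_zero (s := a + 1 - n * z.1) (t := b + 1 - n * z.2) (i := (v.1 : ℤ) - (a + 1))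
    (j := (v.2 : ℤ) - (b + 1)) (by linarith) (by linarith) (by linarith)
    (fun h => h0 (Prod.ext (by simp; omega) (by simp; omega)))
    (fun h => h1 (Prod.ext (by simp; omega) (by simp; omega)))
    (fun h => h2 (Prod.ext (by simp; omega) (by simp; omega)))
  rw [bary, ← hat_neg, ← this]
  push_cast
  congr 1 <;> ring

/-- A node on the lower triangle: the basis function there, in local coordinates. -/
theorem basisFun_lower {n a b k l : ℕ} (ha : a < n) (hb : b < n) (hkl : k + l ≤ 3) {z : ℝ × ℝ}
    (hz : z ∈ lowerTriangle n a b) :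
    basisFun n (3 * a + k, 3 * b + l) z =
      lagrangeFactor (3 - k - l) (1 - (n * z.1 - a) - (n * z.2 - b)) *
        lagrangeFactor k (n * z.1 - a) * lagrangeFactor l (n * z.2 - b) := by
  rw [basisFun_eq_three (u := (a, b)) (v := (a + 1, b)) (w := (a, b + 1)) z
    (by constructor <;> simp <;> omega) (by constructor <;> simp <;> omega)
    (by constructor <;> simp <;> omega) (by simp) (by simp) (by simp)]
  · obtain ⟨h1, h2, h3⟩ := hz
    have e0 : nodeDegree (3 * a + k, 3 * b + l) (a, b) = 3 - k - l := by
      simp only [nodeDegree, abs_eq_max_neg]; push_cast; omega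
    have e1 : nodeDegree (3 * a + k, 3 * b + l) (a + 1, b) = k := by
      simp only [nodeDegree, abs_eq_max_neg]; push_cast; omega
    have e2 : nodeDegree (3 * a + k, 3 * b + l) (a, b + 1) = l := by
      simp only [nodeDegree, abs_eq_max_neg]; push_cast; omega
    rw [e0, e1, e2]
    congr 2
    · congr 1
      exact hat_origin (by linarith) (by linarith) (by linarith)
    · congr 1
      rw [← hat_left (s := n * z.1 - a) (t := n * z.2 - b) (by linarith) (by linarith)
        (by linarith)]
      simp only [bary]; push_cast; congr 1; ring
    · rw [← hat_right (s := n * z.1 - a) (t := n * z.2 - b) (by linarith) (by linarith)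
        (by linarith)]
      simp only [bary]; push_cast; congr 1; ring
  · rintro ⟨x, y⟩ h0 h1 h2
    simp only [ne_eq, Prod.mk.injEq] at h0 h1 h2
    simp only [nodeDegree, abs_eq_max_neg]
    push_cast
    omega

/-- A node on the upper triangle: the basis function there, in local coordinates. -/
theorem basisFun_upper {n a b k l : ℕ} (ha : a < n) (hb : b < n) (hk : k ≤ 3) (hl : l ≤ 3)
    (hkl : 3 ≤ k + l) {z : ℝ × ℝ} (hz : z ∈ upperTriangle n a b) :
    basisFun n (3 * a + k, 3 * b + l) z =
      lagrangeFactor (k + l - 3) (1 - (a + 1 - n * z.1) - (b + 1 - n * z.2)) *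
        lagrangeFactor (3 - k) (a + 1 - n * z.1) * lagrangeFactor (3 - l) (b + 1 - n * z.2) := by
  rw [basisFun_eq_three (u := (a + 1, b + 1)) (v := (a, b + 1)) (w := (a + 1, b)) z
    (by constructor <;> simp <;> omega) (by constructor <;> simp <;> omega)
    (by constructor <;> simp <;> omega) (by simp) (by simp) (by simp)]
  · obtain ⟨h1, h2, h3⟩ := hz
    have e0 : nodeDegree (3 * a + k, 3 * b + l) (a + 1, b + 1) = k + l - 3 := by
      simp only [nodeDegree, abs_eq_max_neg]; push_cast; omega
    have e1 : nodeDegree (3 * a + k, 3 * b + l) (a, b + 1) = 3 - k := by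
      simp only [nodeDegree, abs_eq_max_neg]; push_cast; omega
    have e2 : nodeDegree (3 * a + k, 3 * b + l) (a + 1, b) = 3 - l := by
      simp only [nodeDegree, abs_eq_max_neg]; push_cast; omega
    rw [e0, e1, e2]
    congr 2
    · congr 1
      rw [← hat_origin (s := a + 1 - n * z.1) (t := b + 1 - n * z.2) (by linarith) (by linarith)
        (by linarith), bary, ← hat_neg]
      push_cast; congr 1 <;> ring
    · congr 1
      rw [← hat_left (s := a + 1 - n * z.1) (t := b + 1 - n * z.2) (by linarith) (by linarith)
        (by linarith), bary, ← hat_neg]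
      push_cast; congr 1 <;> ring
    · rw [← hat_right (s := a + 1 - n * z.1) (t := b + 1 - n * z.2) (by linarith) (by linarith)
        (by linarith), bary, ← hat_neg]
      push_cast; congr 1 <;> ring
  · rintro ⟨x, y⟩ h0 h1 h2
    simp only [ne_eq, Prod.mk.injEq] at h0 h1 h2
    simp only [nodeDegree, abs_eq_max_neg]
    push_cast
    omega

theorem nodeDegree_lower {a b k l : ℕ} (hkl : k + l ≤ 3) :
    nodeDegree (3 * a + k, 3 * b + l) (a, b) = 3 - k - l ∧
    nodeDegree (3 * a + k, 3 * b + l) (a + 1, b) = k ∧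
    nodeDegree (3 * a + k, 3 * b + l) (a, b + 1) = l := by
  simp only [nodeDegree, abs_eq_max_neg]
  push_cast
  omega

theorem nodeDegree_upper {a b k l : ℕ} (hk : k ≤ 3) (hl : l ≤ 3) (hkl : 3 ≤ k + l) :
    nodeDegree (3 * a + k, 3 * b + l) (a + 1, b + 1) = k + l - 3 ∧
    nodeDegree (3 * a + k, 3 * b + l) (a, b + 1) = 3 - k ∧
    nodeDegree (3 * a + k, 3 * b + l) (a + 1, b) = 3 - l := by
  simp only [nodeDegree, abs_eq_max_neg]
  push_cast
  omega

/-- Cell and local coordinates of a node. -/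
theorem exists_local {n : ℕ} {m : ℕ × ℕ} (h1 : m.1 < 3 * n) (h2 : m.2 < 3 * n) :
    ∃ c d k l : ℕ, m = (3 * c + k, 3 * d + l) ∧ c < n ∧ d < n ∧ k ≤ 2 ∧ l ≤ 2 :=
  ⟨m.1 / 3, m.2 / 3, m.1 % 3, m.2 % 3, Prod.ext (by simp; omega) (by simp; omega),
    by omega, by omega, by omega, by omega⟩

/-- Some vertex of the mesh that is not on the lower triangle sees a node off that triangle. -/
theorem exists_degree_lower {n a b : ℕ} {m : ℕ × ℕ} (h1 : m.1 < 3 * n) (h2 : m.2 < 3 * n)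
    (h : ¬ (3 * a ≤ m.1 ∧ 3 * b ≤ m.2 ∧ m.1 + m.2 ≤ 3 * a + 3 * b + 3)) :
    ∃ v : ℕ × ℕ, (v.1 ≤ n ∧ v.2 ≤ n) ∧ nodeDegree m v ≠ 0 ∧
      v ≠ (a, b) ∧ v ≠ (a + 1, b) ∧ v ≠ (a, b + 1) := by
  obtain ⟨c, d, k, l, rfl, hc, hd, hk, hl⟩ := exists_local h1 h2
  by_contra! H
  rcases le_total (k + l) 3 with hkl | hkl
  · obtain ⟨e0, e1, e2⟩ := nodeDegree_lower (a := c) (b := d) hkl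
    have H0 := H (c, d); have H1 := H (c + 1, d); have H2 := H (c, d + 1)
    rw [e0] at H0; rw [e1] at H1; rw [e2] at H2
    simp only [ne_eq, Prod.mk.injEq] at H0 H1 H2 h
    omega
  · obtain ⟨e0, e1, e2⟩ := nodeDegree_upper (a := c) (b := d) (by omega) (by omega) hkl
    have H0 := H (c + 1, d + 1); have H1 := H (c, d + 1); have H2 := H (c + 1, d)
    rw [e0] at H0; rw [e1] at H1; rw [e2] at H2
    simp only [ne_eq, Prod.mk.injEq] at H0 H1 H2 h
    omega

/-- Some vertex of the mesh that is not on the upper triangle sees a node off that triangle. -/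
theorem exists_degree_upper {n a b : ℕ} {m : ℕ × ℕ} (h1 : m.1 < 3 * n) (h2 : m.2 < 3 * n)
    (h : ¬ (m.1 ≤ 3 * a + 3 ∧ m.2 ≤ 3 * b + 3 ∧ 3 * a + 3 * b + 3 ≤ m.1 + m.2)) :
    ∃ v : ℕ × ℕ, (v.1 ≤ n ∧ v.2 ≤ n) ∧ nodeDegree m v ≠ 0 ∧
      v ≠ (a + 1, b + 1) ∧ v ≠ (a, b + 1) ∧ v ≠ (a + 1, b) := by
  obtain ⟨c, d, k, l, rfl, hc, hd, hk, hl⟩ := exists_local h1 h2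
  by_contra! H
  rcases le_total (k + l) 3 with hkl | hkl
  · obtain ⟨e0, e1, e2⟩ := nodeDegree_lower (a := c) (b := d) hkl
    have H0 := H (c, d); have H1 := H (c + 1, d); have H2 := H (c, d + 1)
    rw [e0] at H0; rw [e1] at H1; rw [e2] at H2
    simp only [ne_eq, Prod.mk.injEq] at H0 H1 H2 h
    omega
  · obtain ⟨e0, e1, e2⟩ := nodeDegree_upper (a := c) (b := d) (by omega) (by omega) hkl
    have H0 := H (c + 1, d + 1); have H1 := H (c, d + 1); have H2 := H (c + 1, d)
    rw [e0] at H0; rw [e1] at H1; rw [e2] at H2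
    simp only [ne_eq, Prod.mk.injEq] at H0 H1 H2 h
    omega

/-- The basis function of a node off the lower triangle vanishes there. -/
theorem basisFun_lower_zero {n a b : ℕ} {m : ℕ × ℕ} (h1 : m.1 < 3 * n) (h2 : m.2 < 3 * n)
    (h : ¬ (3 * a ≤ m.1 ∧ 3 * b ≤ m.2 ∧ m.1 + m.2 ≤ 3 * a + 3 * b + 3)) {z : ℝ × ℝ}
    (hz : z ∈ lowerTriangle n a b) : basisFun n m z = 0 := by
  obtain ⟨v, hv, hd, hv0, hv1, hv2⟩ := exists_degree_lower h1 h2 h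
  exact basisFun_eq_zero hv hd (bary_lower_zero hz hv0 hv1 hv2)

/-- The basis function of a node off the upper triangle vanishes there. -/
theorem basisFun_upper_zero {n a b : ℕ} {m : ℕ × ℕ} (h1 : m.1 < 3 * n) (h2 : m.2 < 3 * n)
    (h : ¬ (m.1 ≤ 3 * a + 3 ∧ m.2 ≤ 3 * b + 3 ∧ 3 * a + 3 * b + 3 ≤ m.1 + m.2)) {z : ℝ × ℝ}
    (hz : z ∈ upperTriangle n a b) : basisFun n m z = 0 := by
  obtain ⟨v, hv, hd, hv0, hv1, hv2⟩ := exists_degree_upper h1 h2 h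
  exact basisFun_eq_zero hv hd (bary_upper_zero hz hv0 hv1 hv2)

theorem continuous_basisFun (n : ℕ) (m : ℕ × ℕ) : Continuous (basisFun n m) := by
  unfold basisFun lagrangeFactor bary hat
  fun_prop

theorem exists_lagrangeFactor_poly (k : ℕ) (p q r : ℝ) :
    ∃ P : MvPolynomial (Fin 2) ℝ, P.totalDegree ≤ k ∧
      ∀ z : ℝ × ℝ, lagrangeFactor k (p + q * z.1 + r * z.2) =
        MvPolynomial.eval ![z.1, z.2] P := by
  open MvPolynomial in
  refine ⟨∏ j ∈ Finset.range k, (C ((3 * p - j) / (j + 1)) + C (3 * q / (j + 1)) * X 0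
    + C (3 * r / (j + 1)) * X 1), ?_, ?_⟩
  · refine (totalDegree_finsetProd _ _).trans ?_
    refine (Finset.sum_le_card_nsmul _ _ 1 ?_).trans (by simp)
    intro j _
    have hX : ∀ (c : ℝ) (i : Fin 2), (C c * X i : MvPolynomial (Fin 2) ℝ).totalDegree ≤ 1 := by
      intro c i
      refine (totalDegree_mul _ _).trans ?_
      simp
    refine (totalDegree_add _ _).trans (max_le ((totalDegree_add _ _).trans (max_le ?_ (hX _ _)))
      (hX _ _))
    simp
  · intro z
    simp only [lagrangeFactor, map_prod, map_add, map_mul, eval_C, eval_X]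
    refine Finset.prod_congr rfl fun j _ => ?_
    simp
    ring

theorem isCubicOn_of_factors {φ : ℝ × ℝ → ℝ} {K : Set (ℝ × ℝ)} {k₀ k₁ k₂ : ℕ}
    (hk : k₀ + k₁ + k₂ ≤ 3) (p q r : Fin 3 → ℝ)
    (h : ∀ z ∈ K, φ z = lagrangeFactor k₀ (p 0 + q 0 * z.1 + r 0 * z.2) *
      lagrangeFactor k₁ (p 1 + q 1 * z.1 + r 1 * z.2) *
      lagrangeFactor k₂ (p 2 + q 2 * z.1 + r 2 * z.2)) : IsCubicOn φ K := by
  obtain ⟨P, hP, hP'⟩ := exists_lagrangeFactor_poly k₀ (p 0) (q 0) (r 0)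
  obtain ⟨Q, hQ, hQ'⟩ := exists_lagrangeFactor_poly k₁ (p 1) (q 1) (r 1)
  obtain ⟨R, hR, hR'⟩ := exists_lagrangeFactor_poly k₂ (p 2) (q 2) (r 2)
  refine ⟨P * Q * R, ?_, fun z hz => ?_⟩
  · have := MvPolynomial.totalDegree_mul (P * Q) R
    have := MvPolynomial.totalDegree_mul P Q
    omega
  · rw [h z hz, hP', hQ', hR', map_mul, map_mul]

theorem isCubicOn_zero {φ : ℝ × ℝ → ℝ} {K : Set (ℝ × ℝ)} (h : ∀ z ∈ K, φ z = 0) :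
    IsCubicOn φ K := ⟨0, by simp, fun z hz => by rw [h z hz, map_zero]⟩

theorem mem_triangle {n : ℕ} (hn : 1 ≤ n) {z : ℝ × ℝ} (hz : z ∈ closure unitSquare) :
    ∃ a < n, ∃ b < n, z ∈ lowerTriangle n a b ∨ z ∈ upperTriangle n a b := by
  have key : ∀ x : ℝ, 0 ≤ x → x ≤ 1 → ∃ a < n, (a : ℝ) ≤ n * x ∧ n * x ≤ a + 1 := by
    intro x h0 h1
    have hn' : (1 : ℝ) ≤ n := by exact_mod_cast hn
    have hx0 : 0 ≤ (n : ℝ) * x := by positivity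
    rcases lt_or_ge ⌊(n : ℝ) * x⌋₊ n with h | h
    · exact ⟨_, h, Nat.floor_le hx0, (Nat.lt_floor_add_one _).le⟩
    · have h3 : (n : ℝ) ≤ n * x := (Nat.le_floor_iff hx0).1 h
      refine ⟨n - 1, by omega, ?_, ?_⟩
      · push_cast [Nat.cast_sub hn]; linarith
      · push_cast [Nat.cast_sub hn]; nlinarith
  rw [unitSquare, closure_prod_eq, closure_Ioo (by norm_num)] at hz
  obtain ⟨⟨hx0, hx1⟩, hy0, hy1⟩ := hz
  obtain ⟨a, ha, ha1, ha2⟩ := key _ hx0 hx1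
  obtain ⟨b, hb, hb1, hb2⟩ := key _ hy0 hy1
  refine ⟨a, ha, b, hb, ?_⟩
  rcases le_total (n * z.1 + n * z.2) ((a : ℝ) + b + 1) with h | h
  · exact Or.inl ⟨ha1, hb1, h⟩
  · exact Or.inr ⟨ha2, hb2, h⟩

/-- On every side of the square, some vertex off that side has positive degree at an internal
node; the sides are numbered `0` (left), `1` (bottom), `2` (right), `3` (top). -/
theorem exists_degree_side {n : ℕ} {m : ℕ × ℕ} (h1 : m.1 < 3 * n) (h2 : m.2 < 3 * n) (σ : Fin 4)
    (hσ : 1 ≤ m.1 ∧ 1 ≤ m.2) :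
    ∃ v : ℕ × ℕ, (v.1 ≤ n ∧ v.2 ≤ n) ∧ nodeDegree m v ≠ 0 ∧
      ![1 ≤ v.1, 1 ≤ v.2, v.1 + 1 ≤ n, v.2 + 1 ≤ n] σ := by
  obtain ⟨c, d, k, l, rfl, hc, hd, hk, hl⟩ := exists_local h1 h2
  by_contra! H
  rcases le_total (k + l) 3 with hkl | hkl
  · obtain ⟨e0, e1, e2⟩ := nodeDegree_lower (a := c) (b := d) hkl
    have H0 := H (c, d); have H1 := H (c + 1, d); have H2 := H (c, d + 1)
    rw [e0] at H0; rw [e1] at H1; rw [e2] at H2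
    fin_cases σ <;> simp at H0 H1 H2 hσ <;> omega
  · obtain ⟨e0, e1, e2⟩ := nodeDegree_upper (a := c) (b := d) (by omega) (by omega) hkl
    have H0 := H (c + 1, d + 1); have H1 := H (c, d + 1); have H2 := H (c + 1, d)
    rw [e0] at H0; rw [e1] at H1; rw [e2] at H2
    fin_cases σ <;> simp at H0 H1 H2 hσ <;> omega

/-- The basis function of an internal node belongs to the finite element space. -/
theorem isP3Function_basisFun {n : ℕ} {m : ℕ × ℕ} (hm1 : 1 ≤ m.1) (hm2 : 1 ≤ m.2)
    (h1 : m.1 < 3 * n) (h2 : m.2 < 3 * n) : IsP3Function n (basisFun n m) where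
  continuousOn := (continuous_basisFun n m).continuousOn
  cubic_lower := by
    intro a ha b hb
    by_cases h : 3 * a ≤ m.1 ∧ 3 * b ≤ m.2 ∧ m.1 + m.2 ≤ 3 * a + 3 * b + 3
    · obtain ⟨k, hk⟩ := Nat.exists_eq_add_of_le h.1
      obtain ⟨l, hl⟩ := Nat.exists_eq_add_of_le h.2.1
      have hkl : k + l ≤ 3 := by omega
      have hm : m = (3 * a + k, 3 * b + l) := Prod.ext hk hl
      refine isCubicOn_of_factors (k₀ := 3 - k - l) (k₁ := k) (k₂ := l) (by omega)
        ![1 + a + b, -a, -b] ![-n, n, 0] ![-n, 0, n] fun z hz => ?_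
      rw [hm, basisFun_lower ha hb hkl hz]
      simp only [Matrix.cons_val]
      congr 2
      · congr 1; ring
      · congr 1; ring
      · ring
    · exact isCubicOn_zero fun z hz => basisFun_lower_zero h1 h2 h hz
  cubic_upper := by
    intro a ha b hb
    by_cases h : m.1 ≤ 3 * a + 3 ∧ m.2 ≤ 3 * b + 3 ∧ 3 * a + 3 * b + 3 ≤ m.1 + m.2
    · obtain ⟨k, hk⟩ := Nat.exists_eq_add_of_le (show 3 * a ≤ m.1 by omega)
      obtain ⟨l, hl⟩ := Nat.exists_eq_add_of_le (show 3 * b ≤ m.2 by omega)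
      have hm : m = (3 * a + k, 3 * b + l) := Prod.ext hk hl
      refine isCubicOn_of_factors (k₀ := k + l - 3) (k₁ := 3 - k) (k₂ := 3 - l) (by omega)
        ![-1 - a - b, a + 1, b + 1] ![n, -n, 0] ![n, 0, -n] fun z hz => ?_
      rw [hm, basisFun_upper ha hb (by omega) (by omega) (by omega) hz]
      simp only [Matrix.cons_val]
      congr 2
      · congr 1; ring
      · congr 1; ring
      · ring
    · exact isCubicOn_zero fun z hz => basisFun_upper_zero h1 h2 h hz
  boundary := by
    intro z hz
    have hzc : z ∈ closure unitSquare := frontier_subset_closure hz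
    have hzi : z ∉ unitSquare := by
      have ho : IsOpen unitSquare := isOpen_Ioo.prod isOpen_Ioo
      rw [ho.frontier_eq] at hz
      exact hz.2
    rw [unitSquare, closure_prod_eq, closure_Ioo (by norm_num)] at hzc
    obtain ⟨⟨hx0, hx1⟩, hy0, hy1⟩ := hzc
    have hcase : z.1 = 0 ∨ z.2 = 0 ∨ z.1 = 1 ∨ z.2 = 1 := by
      by_contra! hne
      exact hzi ⟨⟨lt_of_le_of_ne hx0 (Ne.symm hne.1), lt_of_le_of_ne hx1 hne.2.2.1⟩,
        lt_of_le_of_ne hy0 (Ne.symm hne.2.1), lt_of_le_of_ne hy1 hne.2.2.2⟩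
    rcases hcase with h | h | h | h
    · obtain ⟨v, hv, hvd, hv1⟩ := exists_degree_side h1 h2 0 (by omega)
      have hv1 : 1 ≤ v.1 := hv1
      have hv1' : (1 : ℝ) ≤ v.1 := by exact_mod_cast (by omega : 1 ≤ v.1)
      refine basisFun_eq_zero hv hvd (hat_zero_of_left (le_abs.2 (Or.inr ?_)))
      rw [h]; linarith
    · obtain ⟨v, hv, hvd, hv1⟩ := exists_degree_side h1 h2 1 (by omega)
      have hv1 : 1 ≤ v.2 := hv1
      have hv1' : (1 : ℝ) ≤ v.2 := by exact_mod_cast (by omega : 1 ≤ v.2)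
      refine basisFun_eq_zero hv hvd (hat_zero_of_right (le_abs.2 (Or.inr ?_)))
      rw [h]; linarith
    · obtain ⟨v, hv, hvd, hv1⟩ := exists_degree_side h1 h2 2 (by omega)
      have hv1 : v.1 + 1 ≤ n := hv1
      have hv1' : (v.1 : ℝ) + 1 ≤ n := by exact_mod_cast (by omega : v.1 + 1 ≤ n)
      refine basisFun_eq_zero hv hvd (hat_zero_of_left (le_abs.2 (Or.inl ?_)))
      rw [h]; linarith
    · obtain ⟨v, hv, hvd, hv1⟩ := exists_degree_side h1 h2 3 (by omega)
      have hv1 : v.2 + 1 ≤ n := hv1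
      have hv1' : (v.2 : ℝ) + 1 ≤ n := by exact_mod_cast (by omega : v.2 + 1 ≤ n)
      refine basisFun_eq_zero hv hvd (hat_zero_of_right (le_abs.2 (Or.inl ?_)))
      rw [h]; linarith

theorem node_mem_lower {n c d k l : ℕ} (hn : 1 ≤ n) (hkl : k + l ≤ 3) :
    node n (3 * c + k, 3 * d + l) ∈ lowerTriangle n c d := by
  have hn' : (n : ℝ) ≠ 0 := by positivity
  have hkl' : (k : ℝ) + l ≤ 3 := by exact_mod_cast hkl
  have hk : (0 : ℝ) ≤ k := by positivity
  have hl : (0 : ℝ) ≤ l := by positivity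
  have e1 : (n : ℝ) * (node n (3 * c + k, 3 * d + l)).1 = c + k / 3 := by
    simp only [node]; push_cast; field_simp
  have e2 : (n : ℝ) * (node n (3 * c + k, 3 * d + l)).2 = d + l / 3 := by
    simp only [node]; push_cast; field_simp
  refine ⟨?_, ?_, ?_⟩ <;> simp only [e1, e2] <;> linarith

theorem node_mem_upper {n c d k l : ℕ} (hn : 1 ≤ n) (hk : k ≤ 3) (hl : l ≤ 3) (hkl : 3 ≤ k + l) :
    node n (3 * c + k, 3 * d + l) ∈ upperTriangle n c d := by
  have hn' : (n : ℝ) ≠ 0 := by positivity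
  have hkl' : (3 : ℝ) ≤ k + l := by exact_mod_cast hkl
  have hk : (k : ℝ) ≤ 3 := by exact_mod_cast hk
  have hl : (l : ℝ) ≤ 3 := by exact_mod_cast hl
  have e1 : (n : ℝ) * (node n (3 * c + k, 3 * d + l)).1 = c + k / 3 := by
    simp only [node]; push_cast; field_simp
  have e2 : (n : ℝ) * (node n (3 * c + k, 3 * d + l)).2 = d + l / 3 := by
    simp only [node]; push_cast; field_simp
  refine ⟨?_, ?_, ?_⟩ <;> simp only [e1, e2] <;> linarith

theorem choose_mul_choose_mul_choose {i j k i' j' k' : ℕ} (h : i + j + k = i' + j' + k') :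
    ((i'.choose i : ℝ) * (j'.choose j : ℝ) * (k'.choose k : ℝ)) =
      if j = j' ∧ k = k' then 1 else 0 := by
  split_ifs with h1
  · obtain ⟨rfl, rfl⟩ := h1
    obtain rfl : i = i' := by omega
    simp
  · rcases (by omega : i' < i ∨ j' < j ∨ k' < k) with h2 | h2 | h2 <;>
      simp [Nat.choose_eq_zero_of_lt h2]

/-- The basis function of a node is `1` at this node and `0` at every other internal node. -/
theorem basisFun_node {n : ℕ} {m m' : ℕ × ℕ} (h1 : m.1 < 3 * n) (h2 : m.2 < 3 * n)
    (h1' : m'.1 < 3 * n) (h2' : m'.2 < 3 * n) :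
    basisFun n m (node n m') = if m = m' then 1 else 0 := by
  obtain ⟨c, d, k', l', rfl, hc, hd, hk', hl'⟩ := exists_local h1' h2'
  have hn : 1 ≤ n := by omega
  have hn' : (n : ℝ) ≠ 0 := by positivity
  have e1 : (n : ℝ) * (node n (3 * c + k', 3 * d + l')).1 = c + k' / 3 := by
    simp only [node]; push_cast; field_simp
  have e2 : (n : ℝ) * (node n (3 * c + k', 3 * d + l')).2 = d + l' / 3 := by
    simp only [node]; push_cast; field_simp
  rcases le_total (k' + l') 3 with hkl | hkl
  · have hz := node_mem_lower (c := c) (d := d) hn hkl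
    by_cases h : 3 * c ≤ m.1 ∧ 3 * d ≤ m.2 ∧ m.1 + m.2 ≤ 3 * c + 3 * d + 3
    · obtain ⟨k, hk⟩ := Nat.exists_eq_add_of_le h.1
      obtain ⟨l, hl⟩ := Nat.exists_eq_add_of_le h.2.1
      obtain rfl : m = (3 * c + k, 3 * d + l) := Prod.ext hk hl
      rw [basisFun_lower hc hd (by omega) hz, e1, e2]
      have a0 : 1 - ((c : ℝ) + k' / 3 - c) - ((d : ℝ) + l' / 3 - d)
          = ((3 - k' - l' : ℕ) : ℝ) / 3 := by
        rw [Nat.sub_sub, Nat.cast_sub hkl]; push_cast; ring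
      have a1 : (c : ℝ) + k' / 3 - c = (k' : ℝ) / 3 := by ring
      have a2 : (d : ℝ) + l' / 3 - d = (l' : ℝ) / 3 := by ring
      rw [a0, a1, a2, lagrangeFactor_eq_choose, lagrangeFactor_eq_choose,
        lagrangeFactor_eq_choose, choose_mul_choose_mul_choose (by omega)]
      simp
    · rw [basisFun_lower_zero h1 h2 h hz, if_neg]
      rintro rfl
      exact h (by simp only; omega)
  · have hz := node_mem_upper (c := c) (d := d) hn (by omega) (by omega) hkl
    by_cases h : m.1 ≤ 3 * c + 3 ∧ m.2 ≤ 3 * d + 3 ∧ 3 * c + 3 * d + 3 ≤ m.1 + m.2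
    · obtain ⟨k, hk⟩ := Nat.exists_eq_add_of_le (show 3 * c ≤ m.1 by omega)
      obtain ⟨l, hl⟩ := Nat.exists_eq_add_of_le (show 3 * d ≤ m.2 by omega)
      obtain rfl : m = (3 * c + k, 3 * d + l) := Prod.ext hk hl
      simp only at h
      rw [basisFun_upper hc hd (by omega) (by omega) (by omega) hz, e1, e2]
      have a0 : 1 - ((c : ℝ) + 1 - (c + k' / 3)) - ((d : ℝ) + 1 - (d + l' / 3))
          = ((k' + l' - 3 : ℕ) : ℝ) / 3 := by
        rw [Nat.cast_sub hkl]; push_cast; ring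
      have a1 : (c : ℝ) + 1 - (c + k' / 3) = ((3 - k' : ℕ) : ℝ) / 3 := by
        rw [Nat.cast_sub (by omega)]; push_cast; ring
      have a2 : (d : ℝ) + 1 - (d + l' / 3) = ((3 - l' : ℕ) : ℝ) / 3 := by
        rw [Nat.cast_sub (by omega)]; push_cast; ring
      rw [a0, a1, a2, lagrangeFactor_eq_choose, lagrangeFactor_eq_choose,
        lagrangeFactor_eq_choose, choose_mul_choose_mul_choose (by omega)]
      refine if_congr ?_ rfl rfl
      simp only [Prod.mk.injEq]
      omega
    · rw [basisFun_upper_zero h1 h2 h hz, if_neg]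
      rintro rfl
      exact h (by simp only; omega)

end P3FEM

namespace P3FEM

/-! ### Spectral estimates for Hermitian matrices -/

section Hermitian

open Matrix

/-! Both matrices are finite compressions of one Laurent operator on `ℤ × ℤ` with 9 × 9 blocks,
whose symbol is the trigonometric polynomial `symbolP3` with frequencies in `{-1, 0, 1}²`. For the
Toeplitz matrix this is the definition. For the stiffness matrix it holds exactly, boundary
included, once the internal nodes are grouped three by three in each direction
(`stiffness_eq_laurentCompression`).

A coefficient vector `x` becomes a vector-valued trigonometric polynomial `p`. The quadratic form of
the compression at `x` is the mean of the quadratic form of the symbol at `p`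
(`torusMean_quadratic`), and `‖x‖²` is the mean of `‖p‖²` (`torusMean_parseval`). Every eigenvalue
therefore lies between the extreme points of the range, which is a compact set of reals; this gives
the convex hull.

For the clustering let `c` be at distance at least `ε` from the range. Then `‖(f - c) p‖ ≥ ε ‖p‖`
pointwise. If `x` is supported on indices all of whose neighbouring blocks are present, the
compression acts on `x` as multiplication by the symbol, so `‖(A - c) x‖ ≥ ε ‖x‖`. By a dimension
count at most as many eigenvalues lie closer than `ε` to `c` as there are indices off this interior,
that is, `O(n)`. Compactness reduces all outliers to finitely many centres `c`, their number
independent of `n`, whence `O(n) = o(n²)` outliers. No limit theorem on eigenvalue distributions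
enters.

The coefficients of the stiffness matrix come from one element matrix: both kinds of triangles are
images of the reference triangle under homotheties of ratio `± 1 / n`, and in dimension two the
Dirichlet energy is invariant under scaling. Integrals of monomials over the reference triangle are
explicit, and after clearing denominators the comparison with the symbol is a finite computation
with integers. -/

theorem star_dotProduct_self {ι : Type*} [Fintype ι] (x : ι → ℂ) :
    star x ⬝ᵥ x = ((∑ i, ‖x i‖ ^ 2 : ℝ) : ℂ) := by
  simp only [dotProduct, Pi.star_apply, RCLike.star_def, Complex.conj_mul']
  push_cast
  rfl

variable {ι : Type*} [Fintype ι] [DecidableEq ι] {A : Matrix ι ι ℂ}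

theorem sum_norm_sq_unitary_mulVec (U : Matrix.unitaryGroup ι ℂ) (x : ι → ℂ) :
    ∑ i, ‖((U : Matrix ι ι ℂ) *ᵥ x) i‖ ^ 2 = ∑ i, ‖x i‖ ^ 2 := by
  have h : star ((U : Matrix ι ι ℂ) *ᵥ x) ⬝ᵥ ((U : Matrix ι ι ℂ) *ᵥ x) = star x ⬝ᵥ x := by
    rw [star_mulVec, dotProduct_mulVec, vecMul_vecMul, ← star_eq_conjTranspose,
      Unitary.coe_star_mul_self, vecMul_one]
  rw [star_dotProduct_self, star_dotProduct_self] at h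
  exact_mod_cast h

theorem unitary_mulVec_star_mulVec (U : Matrix.unitaryGroup ι ℂ) (x : ι → ℂ) :
    (U : Matrix ι ι ℂ) *ᵥ (star (U : Matrix ι ι ℂ) *ᵥ x) = x := by
  rw [mulVec_mulVec, Unitary.mul_star_self_of_mem U.2, one_mulVec]

/-- The spectral theorem in eigenbasis coordinates. The estimates below write a vector as `U a`, so
that norms and quadratic forms become weighted sums of `‖a i‖ ^ 2`. -/
theorem IsHermitian.mulVec_unitary (hA : A.IsHermitian) (a : ι → ℂ) :
    A *ᵥ ((hA.eigenvectorUnitary : Matrix ι ι ℂ) *ᵥ a) =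
      (hA.eigenvectorUnitary : Matrix ι ι ℂ) *ᵥ (fun i => (hA.eigenvalues i : ℂ) * a i) := by
  conv_lhs => enter [1]; rw [hA.spectral_theorem]
  rw [Unitary.conjStarAlgAut_apply, mulVec_mulVec, mul_assoc, mul_assoc, Unitary.coe_star_mul_self,
    mul_one, ← mulVec_mulVec]
  congr 1
  ext i
  simp [mulVec_diagonal]

theorem IsHermitian.sum_norm_sq_sub (hA : A.IsHermitian) (c : ℝ) (a : ι → ℂ) :
    ∑ i, ‖(A *ᵥ ((hA.eigenvectorUnitary : Matrix ι ι ℂ) *ᵥ a) -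
      (c : ℂ) • ((hA.eigenvectorUnitary : Matrix ι ι ℂ) *ᵥ a)) i‖ ^ 2 =
      ∑ i, (hA.eigenvalues i - c) ^ 2 * ‖a i‖ ^ 2 := by
  rw [IsHermitian.mulVec_unitary, ← mulVec_smul, ← mulVec_sub, sum_norm_sq_unitary_mulVec]
  refine Finset.sum_congr rfl fun i _ => ?_
  simp only [Pi.sub_apply, Pi.smul_apply, smul_eq_mul, ← sub_mul, norm_mul, mul_pow,
    ← Complex.ofReal_sub, Complex.norm_real, Real.norm_eq_abs, sq_abs]

theorem IsHermitian.dotProduct_mulVec_unitary (hA : A.IsHermitian) (a : ι → ℂ) :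
    star ((hA.eigenvectorUnitary : Matrix ι ι ℂ) *ᵥ a) ⬝ᵥ
      (A *ᵥ ((hA.eigenvectorUnitary : Matrix ι ι ℂ) *ᵥ a)) =
      ((∑ i, hA.eigenvalues i * ‖a i‖ ^ 2 : ℝ) : ℂ) := by
  rw [IsHermitian.mulVec_unitary, star_mulVec, dotProduct_mulVec, vecMul_vecMul,
    ← star_eq_conjTranspose, Unitary.coe_star_mul_self, vecMul_one]
  simp only [dotProduct, Pi.star_apply, RCLike.star_def]
  push_cast
  refine Finset.sum_congr rfl fun i _ => ?_
  rw [mul_left_comm, Complex.conj_mul']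

/-- If the spectrum keeps the distance `ε` from `c`, then `‖(A - c) x‖ ≥ ε ‖x‖`. -/
theorem IsHermitian.le_sum_norm_sq_sub (hA : A.IsHermitian) {c ε : ℝ} (hε : 0 ≤ ε)
    (h : ∀ z ∈ spectrum ℂ A, ε ≤ dist z (c : ℂ)) (x : ι → ℂ) :
    ε ^ 2 * ∑ i, ‖x i‖ ^ 2 ≤ ∑ i, ‖(A *ᵥ x - (c : ℂ) • x) i‖ ^ 2 := by
  rw [← unitary_mulVec_star_mulVec hA.eigenvectorUnitary x, IsHermitian.sum_norm_sq_sub,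
    sum_norm_sq_unitary_mulVec, Finset.mul_sum]
  refine Finset.sum_le_sum fun i _ => mul_le_mul_of_nonneg_right ?_ (sq_nonneg _)
  have := h (hA.eigenvalues i) (by rw [hA.spectrum_eq_image_range]; exact ⟨_, ⟨i, rfl⟩, rfl⟩)
  rw [Complex.dist_eq, ← Complex.ofReal_sub, Complex.norm_real, Real.norm_eq_abs] at this
  rw [← sq_abs (_ - _)]
  gcongr

/-- Bounds for the spectrum bound the quadratic form. -/
theorem IsHermitian.re_dotProduct_mem (hA : A.IsHermitian) {m M : ℝ}
    (h : ∀ t : ℝ, (t : ℂ) ∈ spectrum ℂ A → m ≤ t ∧ t ≤ M) (x : ι → ℂ) :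
    m * ∑ i, ‖x i‖ ^ 2 ≤ (star x ⬝ᵥ (A *ᵥ x)).re ∧
      (star x ⬝ᵥ (A *ᵥ x)).re ≤ M * ∑ i, ‖x i‖ ^ 2 := by
  have hs i := h (hA.eigenvalues i) (by
    rw [hA.spectrum_eq_image_range]; exact ⟨_, ⟨i, rfl⟩, rfl⟩)
  rw [← unitary_mulVec_star_mulVec hA.eigenvectorUnitary x,
    IsHermitian.dotProduct_mulVec_unitary, sum_norm_sq_unitary_mulVec, Complex.ofReal_re,
    Finset.mul_sum, Finset.mul_sum]
  exact ⟨Finset.sum_le_sum fun i _ => mul_le_mul_of_nonneg_right (hs i).1 (sq_nonneg _),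
    Finset.sum_le_sum fun i _ => mul_le_mul_of_nonneg_right (hs i).2 (sq_nonneg _)⟩

/-- If `‖(A - c) x‖ ≥ ε ‖x‖` for every `x` supported on `J`, then at most `card Jᶜ` eigenvalues lie
within distance less than `ε` of `c`. -/
theorem IsHermitian.card_eigenvalues_near_le (hA : A.IsHermitian) {c ε : ℝ} (J : Finset ι)
    (h : ∀ x : ι → ℂ, (∀ i ∉ J, x i = 0) →
      ε ^ 2 * ∑ i, ‖x i‖ ^ 2 ≤ ∑ i, ‖(A *ᵥ x - (c : ℂ) • x) i‖ ^ 2) :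
    (Finset.univ.filter fun i => |hA.eigenvalues i - c| < ε).card ≤ Jᶜ.card := by
  set S := Finset.univ.filter fun i => |hA.eigenvalues i - c| < ε with hS
  by_contra! hlt
  -- Coordinates on the eigenvectors with eigenvalue close to `c`, extended by zero. `F` below reads
  -- off the entries outside `J` of the combination; more near eigenvalues than such entries would
  -- force a nonzero kernel.
  let ext : (S → ℂ) →ₗ[ℂ] (ι → ℂ) :=
    { toFun := fun a i => if hi : i ∈ S then a ⟨i, hi⟩ else 0
      map_add' := fun a b => by ext i; by_cases hi : i ∈ S <;> simp [hi]
      map_smul' := fun t a => by ext i; by_cases hi : i ∈ S <;> simp [hi] }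
  let U : (ι → ℂ) →ₗ[ℂ] (ι → ℂ) := (hA.eigenvectorUnitary : Matrix ι ι ℂ).mulVecLin
  let F : (S → ℂ) →ₗ[ℂ] ((Jᶜ : Finset ι) → ℂ) :=
    LinearMap.funLeft ℂ ℂ (fun i : (Jᶜ : Finset ι) => (i : ι)) ∘ₗ U ∘ₗ ext
  have hker : LinearMap.ker F ≠ ⊥ := LinearMap.ker_ne_bot_of_finrank_lt (by
    simpa [Finset.card_compl] using hlt)
  obtain ⟨a, ha, ha0⟩ := Submodule.exists_mem_ne_zero_of_ne_bot hker
  have hx := h (U (ext a)) fun i hi => congrFun ha ⟨i, Finset.mem_compl.2 hi⟩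
  have hext : ∀ i ∉ S, ext a i = 0 := fun i hi => dif_neg hi
  change ε ^ 2 * ∑ i, ‖((hA.eigenvectorUnitary : Matrix ι ι ℂ) *ᵥ ext a) i‖ ^ 2 ≤
    ∑ i, ‖(A *ᵥ ((hA.eigenvectorUnitary : Matrix ι ι ℂ) *ᵥ ext a) -
      (c : ℂ) • ((hA.eigenvectorUnitary : Matrix ι ι ℂ) *ᵥ ext a)) i‖ ^ 2 at hx
  rw [IsHermitian.sum_norm_sq_sub, sum_norm_sq_unitary_mulVec, Finset.mul_sum] at hx
  -- The kernel vector is supported on `J`, yet combines only eigenvectors with `|λ - c| < ε`, so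
  -- the reverse inequality is strict.
  refine hx.not_gt (Finset.sum_lt_sum (fun i _ => ?_) ?_)
  · by_cases hi : i ∈ S
    · refine mul_le_mul_of_nonneg_right ?_ (sq_nonneg _)
      have hi' := (Finset.mem_filter.1 hi).2
      rw [← sq_abs (_ - _)]
      gcongr
    · simp [hext i hi]
  · obtain ⟨i, hi⟩ := Function.ne_iff.1 ha0
    have hi' := (Finset.mem_filter.1 i.2).2
    refine ⟨i, Finset.mem_univ _, mul_lt_mul_of_pos_right ?_ ?_⟩
    · rw [← sq_abs (_ - _)]
      gcongr
    · have : ext a i = a i := dif_pos i.2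
      rw [this]
      have := norm_pos_iff.2 hi
      positivity

/-- The roots of the characteristic polynomial of a Hermitian matrix are its eigenvalue family, so
counting algebraic multiplicities is counting indices. -/
theorem IsHermitian.numOutliers_eq (hA : A.IsHermitian) (S : Set ℂ) (ε : ℝ) [DecidablePred
    fun i => (hA.eigenvalues i : ℂ) ∉ ⋃ w ∈ S, Metric.ball w ε] :
    numOutliers A S ε = (Finset.univ.filter fun i =>
      (hA.eigenvalues i : ℂ) ∉ ⋃ w ∈ S, Metric.ball w ε).card := by
  classical
  unfold numOutliers
  rw [hA.roots_charpoly_eq_eigenvalues, Multiset.filter_map, Multiset.card_map]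
  rw [Finset.card_def, Finset.filter_val]
  congr 1
  exact Multiset.filter_congr fun i _ => by simp

end Hermitian

/-! ### Means of trigonometric polynomials -/

section Mean

/-- The character `θ ↦ exp (i (k₁ θ₁ + k₂ θ₂))`. -/
noncomputable def torusChar (k : ℤ × ℤ) (θ : ℝ × ℝ) : ℂ :=
  Complex.exp (Complex.I * ((k.1 : ℂ) * (θ.1 : ℂ) + (k.2 : ℂ) * (θ.2 : ℂ)))

/-- The square `[-π, π]²`. -/
def torusBox : Set (ℝ × ℝ) := Icc (-Real.pi) Real.pi ×ˢ Icc (-Real.pi) Real.pi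

/-- The mean value over `[-π, π]²`. -/
noncomputable def torusMean (h : ℝ × ℝ → ℂ) : ℂ :=
  (1 / (2 * (Real.pi : ℂ)) ^ 2) * ∫ θ in torusBox, h θ

theorem isCompact_torusBox : IsCompact torusBox := isCompact_Icc.prod isCompact_Icc

theorem torusChar_add (k l : ℤ × ℤ) (θ : ℝ × ℝ) :
    torusChar (k + l) θ = torusChar k θ * torusChar l θ := by
  rw [torusChar, torusChar, torusChar, ← Complex.exp_add]
  congr 1
  push_cast [Prod.fst_add, Prod.snd_add]
  ring

@[simp] theorem torusChar_zero (θ : ℝ × ℝ) : torusChar 0 θ = 1 := by simp [torusChar]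

theorem star_torusChar (k : ℤ × ℤ) (θ : ℝ × ℝ) : star (torusChar k θ) = torusChar (-k) θ := by
  rw [torusChar, torusChar, Complex.star_def, ← Complex.exp_conj]
  congr 1
  simp
  ring

theorem continuous_torusChar (k : ℤ × ℤ) : Continuous (torusChar k) := by
  unfold torusChar
  fun_prop

theorem integral_exp_int (k : ℤ) :
    ∫ t in Icc (-Real.pi) Real.pi, Complex.exp (Complex.I * ((k : ℂ) * (t : ℂ))) =
      if k = 0 then 2 * (Real.pi : ℂ) else 0 := by
  have hpi := Real.pi_pos
  rw [integral_Icc_eq_integral_Ioc, ← intervalIntegral.integral_of_le (by linarith)]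
  split_ifs with hk
  · subst hk
    simp
    ring
  · have hc : Complex.I * (k : ℂ) ≠ 0 := mul_ne_zero Complex.I_ne_zero (Int.cast_ne_zero.2 hk)
    simp only [← mul_assoc]
    rw [integral_exp_mul_complex hc, div_eq_zero_iff]
    left
    rw [sub_eq_zero, Complex.exp_eq_exp_iff_exists_int]
    -- The exponents at `π` and `-π` differ by `k` periods `2πi`, so the antiderivative takes equal
    -- values at both ends.
    exact ⟨k, by push_cast; ring⟩

theorem torusMean_torusChar (k : ℤ × ℤ) : torusMean (torusChar k) = if k = 0 then 1 else 0 := by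
  have h : ∀ θ : ℝ × ℝ, torusChar k θ = Complex.exp (Complex.I * ((k.1 : ℂ) * (θ.1 : ℂ))) *
      Complex.exp (Complex.I * ((k.2 : ℂ) * (θ.2 : ℂ))) := fun θ => by
    rw [torusChar, mul_add, Complex.exp_add]
  have hpi : (Real.pi : ℂ) ≠ 0 := Complex.ofReal_ne_zero.2 Real.pi_ne_zero
  simp only [torusMean, h, torusBox]
  rw [Measure.volume_eq_prod, setIntegral_prod_mul
    (fun t : ℝ => Complex.exp (Complex.I * ((k.1 : ℂ) * (t : ℂ))))
    (fun t : ℝ => Complex.exp (Complex.I * ((k.2 : ℂ) * (t : ℂ)))), integral_exp_int,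
    integral_exp_int]
  by_cases h1 : k.1 = 0 <;> by_cases h2 : k.2 = 0 <;> simp [h1, h2, Prod.ext_iff]
  field_simp

theorem integrableOn_torusBox {h : ℝ × ℝ → ℂ} (hh : Continuous h) : IntegrableOn h torusBox :=
  hh.continuousOn.integrableOn_compact isCompact_torusBox

theorem torusMean_sum {κ : Type*} (s : Finset κ) {h : κ → ℝ × ℝ → ℂ}
    (hh : ∀ i ∈ s, Continuous (h i)) :
    torusMean (fun θ => ∑ i ∈ s, h i θ) = ∑ i ∈ s, torusMean (h i) := by
  simp only [torusMean]
  rw [integral_finsetSum s fun i hi => integrableOn_torusBox (hh i hi), Finset.mul_sum]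

theorem torusMean_const_mul (c : ℂ) (h : ℝ × ℝ → ℂ) :
    torusMean (fun θ => c * h θ) = c * torusMean h := by
  simp only [torusMean, integral_const_mul]
  ring

theorem re_torusMean_mono {h₁ h₂ : ℝ × ℝ → ℂ} (hh₁ : Continuous h₁) (hh₂ : Continuous h₂)
    (h : ∀ θ ∈ torusBox, (h₁ θ).re ≤ (h₂ θ).re) : (torusMean h₁).re ≤ (torusMean h₂).re := by
  have hc : (1 / (2 * (Real.pi : ℂ)) ^ 2) = ((1 / (2 * Real.pi) ^ 2 : ℝ) : ℂ) := by push_cast; rfl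
  have hm : MeasurableSet torusBox := isCompact_torusBox.isClosed.measurableSet
  have e : ∀ {f : ℝ × ℝ → ℂ}, Continuous f →
      (∫ θ in torusBox, f θ).re = ∫ θ in torusBox, (f θ).re := fun hf =>
    (integral_re (𝕜 := ℂ) (integrableOn_torusBox hf)).symm
  rw [torusMean, torusMean, hc, Complex.re_ofReal_mul, Complex.re_ofReal_mul, e hh₁, e hh₂]
  refine mul_le_mul_of_nonneg_left ?_ (by positivity)
  exact setIntegral_mono_on (integrableOn_torusBox hh₁).re (integrableOn_torusBox hh₂).re hm h

end Mean

/-! ### Compressions of Laurent operators with trigonometric polynomial symbols -/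

section Laurent

open Matrix

variable {r : ℕ}

/-- The trigonometric polynomial with coefficients `F k`, `k ∈ S`. -/
noncomputable def trigSymbol (F : ℤ × ℤ → Matrix (Fin r) (Fin r) ℂ) (S : Finset (ℤ × ℤ))
    (θ : ℝ × ℝ) : Matrix (Fin r) (Fin r) ℂ :=
  ∑ k ∈ S, torusChar k θ • F k

theorem trigSymbol_apply (F : ℤ × ℤ → Matrix (Fin r) (Fin r) ℂ) (S : Finset (ℤ × ℤ))
    (θ : ℝ × ℝ) (a b : Fin r) : trigSymbol F S θ a b = ∑ k ∈ S, F k a b * torusChar k θ := by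
  simp [trigSymbol, Matrix.sum_apply, mul_comm]

theorem continuous_trigSymbol (F : ℤ × ℤ → Matrix (Fin r) (Fin r) ℂ) (S : Finset (ℤ × ℤ)) :
    Continuous (trigSymbol F S) := by
  unfold trigSymbol
  exact continuous_finsetSum _ fun k _ => (continuous_torusChar k).smul continuous_const

theorem trigSymbol_isHermitian {F : ℤ × ℤ → Matrix (Fin r) (Fin r) ℂ} {S : Finset (ℤ × ℤ)}
    (hS : ∀ k ∈ S, -k ∈ S) (hF : ∀ k, F (-k) = (F k)ᴴ) (θ : ℝ × ℝ) :
    (trigSymbol F S θ).IsHermitian := by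
  unfold trigSymbol
  rw [Matrix.IsHermitian, conjTranspose_sum]
  refine Finset.sum_bij (fun k _ => -k) hS (fun _ _ _ _ h => neg_injective h)
    (fun k hk => ⟨-k, hS k hk, neg_neg k⟩) fun k _ => ?_
  rw [conjTranspose_smul, star_torusChar, hF]

/-- The mean of an entry of a trigonometric polynomial against a character. -/
theorem torusMean_trigSymbol_mul {F : ℤ × ℤ → Matrix (Fin r) (Fin r) ℂ} {S : Finset (ℤ × ℤ)}
    (hF : ∀ k ∉ S, F k = 0) (a b : Fin r) (k : ℤ × ℤ) :
    torusMean (fun θ => trigSymbol F S θ a b * torusChar (-k) θ) = F k a b := by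
  have h : ∀ θ, trigSymbol F S θ a b * torusChar (-k) θ =
      ∑ d ∈ S, F d a b * torusChar (d + -k) θ := fun θ => by
    rw [trigSymbol_apply, Finset.sum_mul]
    exact Finset.sum_congr rfl fun d _ => by rw [torusChar_add]; ring
  simp only [h]
  rw [torusMean_sum S (h := fun d θ => F d a b * torusChar (d + -k) θ)
    fun d _ => continuous_const.mul (continuous_torusChar _)]
  simp only [torusMean_const_mul, torusMean_torusChar, add_neg_eq_zero, mul_ite, mul_one, mul_zero]
  rw [Finset.sum_ite_eq' S k]
  split_ifs with hk
  · rfl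
  · rw [hF k hk]; rfl

/-- The Fourier coefficients of a trigonometric polynomial. -/
theorem fourierCoeff_trigSymbol {F : ℤ × ℤ → Matrix (Fin r) (Fin r) ℂ} {S : Finset (ℤ × ℤ)}
    (hF : ∀ k ∉ S, F k = 0) (k l : ℤ) :
    fourierCoeff (fun θ₁ θ₂ => trigSymbol F S (θ₁, θ₂)) k l = F (k, l) := by
  ext a b
  rw [← torusMean_trigSymbol_mul hF a b (k, l)]
  simp only [fourierCoeff, torusMean, torusBox, torusChar, Matrix.of_apply]
  congr 1
  refine setIntegral_congr_fun (measurableSet_Icc.prod measurableSet_Icc) fun θ _ => ?_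
  simp only [Prod.fst_neg, Prod.snd_neg]
  congr 2
  push_cast
  ring

variable {ι : Type*} [Fintype ι]

/-- The compression to the index set `ι` of the Laurent operator with coefficients `F`. -/
def laurentCompression (F : ℤ × ℤ → Matrix (Fin r) (Fin r) ℂ) (g : ι → (ℤ × ℤ) × Fin r) :
    Matrix ι ι ℂ :=
  Matrix.of fun i j => F ((g i).1 - (g j).1) (g i).2 (g j).2

omit [Fintype ι] in
theorem laurentCompression_isHermitian {F : ℤ × ℤ → Matrix (Fin r) (Fin r) ℂ}
    (hF : ∀ k, F (-k) = (F k)ᴴ) (g : ι → (ℤ × ℤ) × Fin r) :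
    (laurentCompression F g).IsHermitian := by
  ext i j
  simp only [laurentCompression, conjTranspose_apply, Matrix.of_apply]
  rw [← conjTranspose_apply, ← hF, neg_sub]

/-- The vector-valued trigonometric polynomial with the coefficients `x`. -/
noncomputable def trigVec (g : ι → (ℤ × ℤ) × Fin r) (x : ι → ℂ) (θ : ℝ × ℝ) : Fin r → ℂ :=
  ∑ i, Pi.single (g i).2 (x i * torusChar (g i).1 θ)

theorem trigVec_sub_smul (g : ι → (ℤ × ℤ) × Fin r) (x y : ι → ℂ) (c : ℂ) (θ : ℝ × ℝ) :
    trigVec g (x - c • y) θ = trigVec g x θ - c • trigVec g y θ := by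
  simp only [trigVec, Finset.smul_sum, ← Finset.sum_sub_distrib]
  refine Finset.sum_congr rfl fun i _ => ?_
  rw [← Pi.single_smul, ← Pi.single_sub]
  simp only [Pi.sub_apply, Pi.smul_apply, smul_eq_mul]
  congr 1
  ring

theorem continuous_trigVec (g : ι → (ℤ × ℤ) × Fin r) (x : ι → ℂ) : Continuous (trigVec g x) := by
  unfold trigVec
  refine continuous_finsetSum _ fun i _ => ?_
  exact (continuous_single (A := fun _ : Fin r => ℂ) (g i).2).comp
    (continuous_const.mul (continuous_torusChar _))

/-- The quadratic form of a compression is the mean of the quadratic form of the symbol. -/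
theorem torusMean_quadratic {F : ℤ × ℤ → Matrix (Fin r) (Fin r) ℂ} {S : Finset (ℤ × ℤ)}
    (hF : ∀ k ∉ S, F k = 0) (g : ι → (ℤ × ℤ) × Fin r) (x : ι → ℂ) :
    torusMean (fun θ => star (trigVec g x θ) ⬝ᵥ (trigSymbol F S θ *ᵥ trigVec g x θ)) =
      star x ⬝ᵥ (laurentCompression F g *ᵥ x) := by
  -- Sesquilinear expansion: the character in the term `(i, j)` extracts from the symbol the
  -- coefficient at the difference of the two positions, which is the entry of the compression.
  have h : ∀ θ, star (trigVec g x θ) ⬝ᵥ (trigSymbol F S θ *ᵥ trigVec g x θ) =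
      ∑ i, ∑ j, (star (x i) * x j) * (trigSymbol F S θ (g i).2 (g j).2 *
        torusChar (-((g i).1 - (g j).1)) θ) := fun θ => by
    simp only [trigVec, star_sum, sum_dotProduct, mulVec_sum, dotProduct_sum]
    rw [Finset.sum_comm]
    refine Finset.sum_congr rfl fun i _ => Finset.sum_congr rfl fun j _ => ?_
    rw [← Pi.single_star, single_dotProduct, mulVec_single, neg_sub, sub_eq_add_neg, torusChar_add,
      star_mul', star_torusChar]
    simp
    ring
  have hc : ∀ i j, Continuous fun θ => (star (x i) * x j) * (trigSymbol F S θ (g i).2 (g j).2 *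
        torusChar (-((g i).1 - (g j).1)) θ) := fun i j =>
    continuous_const.mul ((((continuous_trigSymbol F S).matrix_elem _ _)).mul
      (continuous_torusChar _))
  simp only [h]
  rw [torusMean_sum _ fun i _ => continuous_finsetSum _ fun j _ => hc i j]
  simp only [dotProduct, mulVec, Finset.mul_sum, Pi.star_apply]
  refine Finset.sum_congr rfl fun i _ => ?_
  rw [torusMean_sum _ fun j _ => hc i j]
  refine Finset.sum_congr rfl fun j _ => ?_
  rw [torusMean_const_mul, torusMean_trigSymbol_mul hF]
  simp only [laurentCompression, Matrix.of_apply]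
  ring

/-- Parseval's identity. -/
theorem torusMean_parseval {g : ι → (ℤ × ℤ) × Fin r} (hg : Function.Injective g) (x : ι → ℂ) :
    torusMean (fun θ => ((∑ a, ‖trigVec g x θ a‖ ^ 2 : ℝ) : ℂ)) = ((∑ i, ‖x i‖ ^ 2 : ℝ) : ℂ) := by
  classical
  -- Parseval is the case of the constant symbol `1`, whose compression is the identity because `g`
  -- is injective.
  have h := torusMean_quadratic (F := fun k => if k = 0 then (1 : Matrix (Fin r) (Fin r) ℂ) else 0)
    (S := {0}) (fun k hk => if_neg (by simpa using hk)) g x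
  have h1 : laurentCompression (fun k => if k = 0 then (1 : Matrix (Fin r) (Fin r) ℂ) else 0) g
      = 1 := by
    ext i j
    simp only [laurentCompression, Matrix.of_apply, sub_eq_zero, Matrix.one_apply]
    by_cases hij : i = j
    · subst hij
      simp
    · rw [if_neg hij]
      split_ifs with h2
      · rw [Matrix.one_apply_ne fun h3 => hij (hg (Prod.ext h2 h3))]
      · rfl
  rw [h1, one_mulVec, star_dotProduct_self] at h
  rw [← h]
  congr 1
  funext θ
  simp [trigSymbol, star_dotProduct_self]

/-- On vectors supported in the interior of the index set the compression acts as the symbol. -/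
theorem trigSymbol_mulVec_trigVec {F : ℤ × ℤ → Matrix (Fin r) (Fin r) ℂ} {S : Finset (ℤ × ℤ)}
    (hF : ∀ k ∉ S, F k = 0) {g : ι → (ℤ × ℤ) × Fin r} (hg : Function.Injective g) {x : ι → ℂ}
    (hx : ∀ j, x j ≠ 0 → ∀ d ∈ S, ∀ a, ∃ i, g i = ((g j).1 + d, a)) (θ : ℝ × ℝ) :
    trigSymbol F S θ *ᵥ trigVec g x θ = trigVec g (laurentCompression F g *ᵥ x) θ := by
  classical
  -- The contribution of `x j` to the position `q` of the full Laurent image. Multiplication by the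
  -- symbol sums it over the shifts of `g j` by `S`, the compression over the positions in the range
  -- of `g`.
  let H (j : ι) (q : (ℤ × ℤ) × Fin r) : Fin r → ℂ :=
    Pi.single q.2 (x j * F (q.1 - (g j).1) q.2 (g j).2 * torusChar q.1 θ)
  have hR : trigVec g (laurentCompression F g *ᵥ x) θ = ∑ j, ∑ i, H j (g i) := by
    rw [Finset.sum_comm, trigVec]
    refine Finset.sum_congr rfl fun i _ => ?_
    have hs := map_sum (AddMonoidHom.single (fun _ : Fin r => ℂ) (g i).2)
      (fun j => x j * F ((g i).1 - (g j).1) (g i).2 (g j).2 * torusChar (g i).1 θ) Finset.univ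
    simp only [AddMonoidHom.single_apply] at hs
    rw [← hs]
    congr 1
    simp only [mulVec, dotProduct, laurentCompression, Matrix.of_apply, Finset.sum_mul]
    exact Finset.sum_congr rfl fun j _ => by ring
  have hL : trigSymbol F S θ *ᵥ trigVec g x θ =
      ∑ j, ∑ q ∈ S ×ˢ (Finset.univ : Finset (Fin r)), H j ((g j).1 + q.1, q.2) := by
    rw [trigVec, mulVec_sum]
    refine Finset.sum_congr rfl fun j _ => ?_
    rw [Finset.sum_product, mulVec_single]
    ext a
    simp only [Finset.sum_apply, H, Pi.smul_apply, col_apply, trigSymbol_apply, add_sub_cancel_left]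
    rw [MulOpposite.smul_eq_mul_unop, Finset.sum_mul]
    refine Finset.sum_congr rfl fun d _ => ?_
    rw [Finset.sum_eq_single a]
    · simp only [Pi.single_eq_same, torusChar_add, MulOpposite.unop_op]
      ring
    · intro b _ hb
      simp [Pi.single_eq_of_ne hb.symm]
    · simp
  rw [hL, hR]
  refine Finset.sum_congr rfl fun j _ => ?_
  by_cases hj : x j = 0
  · simp [H, hj]
  have hinj : Function.Injective fun q : (ℤ × ℤ) × Fin r => ((g j).1 + q.1, q.2) := by
    rintro ⟨k, a⟩ ⟨l, b⟩ h
    simpa using h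
  rw [← Finset.sum_image (f := H j) hg.injOn, ← Finset.sum_image (f := H j)
    (g := fun q : (ℤ × ℤ) × Fin r => ((g j).1 + q.1, q.2)) hinj.injOn]
  -- For an interior `j` the shifted positions all lie in the range of `g`, and the remaining
  -- positions of the range carry a zero coefficient.
  refine Finset.sum_subset (fun q hq => ?_) fun q _ hq => ?_
  · obtain ⟨p, hp, rfl⟩ := Finset.mem_image.1 hq
    obtain ⟨i, hi⟩ := hx j hj p.1 (Finset.mem_product.1 hp).1 p.2
    exact Finset.mem_image.2 ⟨i, Finset.mem_univ _, hi⟩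
  · have : q.1 - (g j).1 ∉ S := fun hS => hq (Finset.mem_image.2
      ⟨(q.1 - (g j).1, q.2), Finset.mem_product.2 ⟨hS, Finset.mem_univ _⟩, by simp⟩)
    simp [H, hF _ this]

end Laurent

/-! ### The range of the symbol and the spectra of the compressions -/

section Range

open Matrix

variable {r : ℕ} {F : ℤ × ℤ → Matrix (Fin r) (Fin r) ℂ} {S : Finset (ℤ × ℤ)}

theorem mem_symbolRange {f : ℝ → ℝ → Matrix (Fin r) (Fin r) ℂ} {z : ℂ} :
    z ∈ symbolRange f ↔ ∃ θ ∈ torusBox, z ∈ spectrum ℂ (f θ.1 θ.2) := by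
  simp only [symbolRange, torusBox, mem_ofPred_eq, mem_prod, Prod.exists]
  exact ⟨fun ⟨a, ha, b, hb, h⟩ => ⟨a, b, ⟨ha, hb⟩, h⟩, fun ⟨a, b, ⟨ha, hb⟩, h⟩ => ⟨a, ha, b, hb, h⟩⟩

theorem mem_spectrum_iff_det {A : Matrix (Fin r) (Fin r) ℂ} {z : ℂ} :
    z ∈ spectrum ℂ A ↔ (algebraMap ℂ (Matrix (Fin r) (Fin r) ℂ) z - A).det = 0 := by
  rw [spectrum.mem_iff, Matrix.isUnit_iff_isUnit_det, isUnit_iff_ne_zero, not_not]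

/-- The range is the projection, along the compact factor `torusBox`, of the closed zero set of the
characteristic determinant. Continuity of individual eigenvalue functions is not needed. -/
theorem isClosed_symbolRange {f : ℝ × ℝ → Matrix (Fin r) (Fin r) ℂ} (hf : Continuous f) :
    IsClosed (symbolRange fun θ₁ θ₂ => f (θ₁, θ₂)) := by
  have : CompactSpace torusBox := isCompact_iff_compactSpace.1 isCompact_torusBox
  have hZ : IsClosed {p : torusBox × ℂ |
      (algebraMap ℂ (Matrix (Fin r) (Fin r) ℂ) p.2 - f p.1).det = 0} := by
    refine isClosed_eq (Continuous.matrix_det ?_) continuous_const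
    simp only [Algebra.algebraMap_eq_smul_one]
    fun_prop
  convert isClosedMap_snd_of_compactSpace _ hZ using 1
  ext z
  rw [mem_symbolRange]
  constructor
  · rintro ⟨θ, hθ, h⟩
    exact ⟨(⟨θ, hθ⟩, z), mem_spectrum_iff_det.1 h, rfl⟩
  · rintro ⟨⟨θ, w⟩, h, rfl⟩
    exact ⟨θ, θ.2, mem_spectrum_iff_det.2 h⟩

-- Eigenvalues are bounded by any submultiplicative matrix norm, up to the factor `‖1‖`, and the
-- symbol is bounded on the compact square. The row-sum norm serves only for this.
attribute [local instance] Matrix.linftyOpNormedRing Matrix.linftyOpNormedAlgebra in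
theorem isCompact_symbolRange {f : ℝ × ℝ → Matrix (Fin r) (Fin r) ℂ} (hf : Continuous f) :
    IsCompact (symbolRange fun θ₁ θ₂ => f (θ₁, θ₂)) := by
  obtain ⟨C, hC⟩ := isCompact_torusBox.exists_bound_of_continuousOn hf.continuousOn
  refine Metric.isCompact_of_isClosed_isBounded (isClosed_symbolRange hf)
    (isBounded_iff_forall_norm_le.2
      ⟨C * ‖(1 : Matrix (Fin r) (Fin r) ℂ)‖, fun z hz => ?_⟩)
  obtain ⟨θ, hθ, h⟩ := mem_symbolRange.1 hz
  exact (spectrum.norm_le_norm_mul_of_mem h).trans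
    (mul_le_mul_of_nonneg_right (hC θ hθ) (norm_nonneg _))

theorem symbolRange_nonempty [NeZero r] {f : ℝ × ℝ → Matrix (Fin r) (Fin r) ℂ}
    (hf : ∀ θ, (f θ).IsHermitian) : (symbolRange fun θ₁ θ₂ => f (θ₁, θ₂)).Nonempty := by
  refine ⟨(hf (0, 0)).eigenvalues 0, mem_symbolRange.2 ⟨(0, 0), ?_, ?_⟩⟩
  · have := Real.pi_pos
    exact ⟨⟨by simp; linarith, by simp; linarith⟩, by simp; linarith, by simp; linarith⟩
  · rw [(hf (0, 0)).spectrum_eq_image_range]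
    exact ⟨_, ⟨0, rfl⟩, rfl⟩

theorem IsHermitian.ofReal_re_of_mem_spectrum {ι : Type*} [Fintype ι] [DecidableEq ι]
    {A : Matrix ι ι ℂ} (hA : A.IsHermitian) {z : ℂ} (hz : z ∈ spectrum ℂ A) :
    ∃ i, z = hA.eigenvalues i := by
  rw [hA.spectrum_eq_image_range] at hz
  obtain ⟨_, ⟨i, rfl⟩, rfl⟩ := hz
  exact ⟨i, rfl⟩

/-- A nonempty range of Hermitian values has extreme points, which are real. -/
theorem exists_extremes_symbolRange [NeZero r] {f : ℝ × ℝ → Matrix (Fin r) (Fin r) ℂ}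
    (hfc : Continuous f) (hf : ∀ θ, (f θ).IsHermitian) :
    ∃ m M : ℝ, (m : ℂ) ∈ (symbolRange fun θ₁ θ₂ => f (θ₁, θ₂)) ∧
      (M : ℂ) ∈ (symbolRange fun θ₁ θ₂ => f (θ₁, θ₂)) ∧
      ∀ t : ℝ, (t : ℂ) ∈ (symbolRange fun θ₁ θ₂ => f (θ₁, θ₂)) → m ≤ t ∧ t ≤ M := by
  set R := symbolRange fun θ₁ θ₂ => f (θ₁, θ₂) with hR
  have hc : IsCompact (Complex.re '' R) := (isCompact_symbolRange hfc).image Complex.continuous_re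
  have hne : (Complex.re '' R).Nonempty := (symbolRange_nonempty hf).image _
  have hre : ∀ z ∈ R, (z.re : ℂ) ∈ R := by
    intro z hz
    obtain ⟨θ, hθ, h⟩ := mem_symbolRange.1 hz
    obtain ⟨i, rfl⟩ := IsHermitian.ofReal_re_of_mem_spectrum (hf _) h
    exact hz
  obtain ⟨_, ⟨z, hz, rfl⟩, hm⟩ := hc.exists_isLeast hne
  obtain ⟨_, ⟨w, hw, rfl⟩, hM⟩ := hc.exists_isGreatest hne
  refine ⟨z.re, w.re, hre z hz, hre w hw, fun t ht => ⟨hm ?_, hM ?_⟩⟩ <;>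
    exact ⟨t, ht, Complex.ofReal_re t⟩

variable {ι : Type*} [Fintype ι] [DecidableEq ι]

/-- Bounds of the range of the symbol are bounds for the eigenvalues of every compression. -/
theorem eigenvalues_laurentCompression_mem (hF : ∀ k ∉ S, F k = 0)
    (hH : ∀ θ, (trigSymbol F S θ).IsHermitian) {g : ι → (ℤ × ℤ) × Fin r}
    (hg : Function.Injective g) (hM : (laurentCompression F g).IsHermitian) {m M : ℝ}
    (h : ∀ t : ℝ, (t : ℂ) ∈ (symbolRange fun θ₁ θ₂ => trigSymbol F S (θ₁, θ₂)) → m ≤ t ∧ t ≤ M)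
    (i : ι) : m ≤ hM.eigenvalues i ∧ hM.eigenvalues i ≤ M := by
  -- The unit eigenvector of the `i`-th eigenvalue; its quadratic form is this eigenvalue.
  set x : ι → ℂ := hM.eigenvectorUnitary.1 *ᵥ Pi.single i 1 with hx
  have hn : ∑ j, ‖x j‖ ^ 2 = 1 := by
    rw [hx, sum_norm_sq_unitary_mulVec, Finset.sum_eq_single i]
    · simp
    · intro j _ hj; simp [Pi.single_eq_of_ne hj]
    · simp
  have hq : star x ⬝ᵥ (laurentCompression F g *ᵥ x) = (hM.eigenvalues i : ℂ) := by
    rw [hx, IsHermitian.dotProduct_mulVec_unitary, Finset.sum_eq_single i]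
    · simp
    · intro j _ hj; simp [Pi.single_eq_of_ne hj]
    · simp
  have hcp := continuous_trigVec g x
  have hcs : Continuous fun θ => ((∑ a, ‖trigVec g x θ a‖ ^ 2 : ℝ) : ℂ) := by fun_prop
  have hcq : Continuous fun θ =>
      star (trigVec g x θ) ⬝ᵥ (trigSymbol F S θ *ᵥ trigVec g x θ) :=
    (hcp.star).dotProduct ((continuous_trigSymbol F S).matrix_mulVec hcp)
  have hb : ∀ θ ∈ torusBox, ∀ t : ℝ, (t : ℂ) ∈ spectrum ℂ (trigSymbol F S θ) → m ≤ t ∧ t ≤ M :=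
    fun θ hθ t ht => h t (mem_symbolRange.2 ⟨θ, hθ, ht⟩)
  -- By Parseval the constants `m` and `M` are themselves means, so the claim reduces to pointwise
  -- bounds of the quadratic form of the symbol.
  have key : ∀ c : ℝ, (torusMean fun θ => (c : ℂ) * ((∑ a, ‖trigVec g x θ a‖ ^ 2 : ℝ) : ℂ)).re
      = c := fun c => by
    rw [torusMean_const_mul, torusMean_parseval hg, hn]; simp
  have hmean : (torusMean fun θ => star (trigVec g x θ) ⬝ᵥ
      (trigSymbol F S θ *ᵥ trigVec g x θ)).re = hM.eigenvalues i := by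
    rw [torusMean_quadratic hF, hq, Complex.ofReal_re]
  constructor
  · rw [← hmean]
    conv_lhs => rw [← key m]
    refine re_torusMean_mono (continuous_const.mul hcs) hcq fun θ hθ => ?_
    rw [Complex.re_ofReal_mul, Complex.ofReal_re]
    exact (IsHermitian.re_dotProduct_mem (hH θ) (hb θ hθ) _).1
  · rw [← hmean]
    conv_rhs => rw [← key M]
    refine re_torusMean_mono hcq (continuous_const.mul hcs) fun θ hθ => ?_
    rw [Complex.re_ofReal_mul, Complex.ofReal_re]
    exact (IsHermitian.re_dotProduct_mem (hH θ) (hb θ hθ) _).2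

/-- The spectrum of a compression lies in the convex hull of the range of the symbol. -/
theorem spectrum_laurentCompression_subset [NeZero r] (hF : ∀ k ∉ S, F k = 0)
    (hH : ∀ θ, (trigSymbol F S θ).IsHermitian) {g : ι → (ℤ × ℤ) × Fin r}
    (hg : Function.Injective g) (hM : (laurentCompression F g).IsHermitian) :
    spectrum ℂ (laurentCompression F g) ⊆
      convexHull ℝ (symbolRange fun θ₁ θ₂ => trigSymbol F S (θ₁, θ₂)) := by
  intro z hz
  obtain ⟨i, rfl⟩ := IsHermitian.ofReal_re_of_mem_spectrum hM hz
  obtain ⟨m, M, hm, hM', hb⟩ := exists_extremes_symbolRange (continuous_trigSymbol F S) hH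
  obtain ⟨h1, h2⟩ := eigenvalues_laurentCompression_mem hF hH hg hM hb i
  -- Both extremes are attained, so the hull contains the whole segment between them.
  refine segment_subset_convexHull hm hM' ?_
  have hseg : hM.eigenvalues i ∈ segment ℝ m M := by
    rw [segment_eq_Icc (h1.trans h2)]; exact ⟨h1, h2⟩
  obtain ⟨a, b, ha, hb, hab, h⟩ := hseg
  exact ⟨a, b, ha, hb, hab, by rw [← h]; simp⟩

/-- If the range of the symbol keeps the distance `ε` from `c`, the number of eigenvalues of a
compression close to `c` is at most the number of indices off the interior. -/
theorem card_eigenvalues_laurentCompression_near_le (hF : ∀ k ∉ S, F k = 0)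
    (hH : ∀ θ, (trigSymbol F S θ).IsHermitian) {g : ι → (ℤ × ℤ) × Fin r}
    (hg : Function.Injective g) (hM : (laurentCompression F g).IsHermitian) {J : Finset ι}
    (hJ : ∀ j ∈ J, ∀ d ∈ S, ∀ a, ∃ i, g i = ((g j).1 + d, a)) {c ε : ℝ} (hε : 0 ≤ ε)
    (hc : ∀ z ∈ symbolRange fun θ₁ θ₂ => trigSymbol F S (θ₁, θ₂), ε ≤ dist z (c : ℂ)) :
    (Finset.univ.filter fun i => |hM.eigenvalues i - c| < ε).card ≤ Jᶜ.card := by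
  refine IsHermitian.card_eigenvalues_near_le hM J fun x hx => ?_
  have hcp := continuous_trigVec g
  have e1 := torusMean_parseval hg x
  have e2 := torusMean_parseval hg (laurentCompression F g *ᵥ x - (c : ℂ) • x)
  -- Compares `ε² ‖p‖²` with `‖(f - c) p‖²` pointwise; Parseval turns the two means into the norms
  -- of `ε x` and `(A - c) x`.
  have hmono := re_torusMean_mono
    (h₁ := fun θ => ((ε ^ 2 : ℝ) : ℂ) * ((∑ a, ‖trigVec g x θ a‖ ^ 2 : ℝ) : ℂ))
    (h₂ := fun θ => ((∑ a, ‖trigVec g (laurentCompression F g *ᵥ x - (c : ℂ) • x) θ a‖ ^ 2 : ℝ) :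
      ℂ)) (by have := hcp x; fun_prop)
    (by have := hcp (laurentCompression F g *ᵥ x - (c : ℂ) • x); fun_prop)
    (fun θ hθ => ?_)
  · rw [torusMean_const_mul, e1, e2, Complex.re_ofReal_mul, Complex.ofReal_re,
      Complex.ofReal_re] at hmono
    exact hmono
  · rw [Complex.re_ofReal_mul, Complex.ofReal_re, Complex.ofReal_re, trigVec_sub_smul,
      ← trigSymbol_mulVec_trigVec hF hg fun j hj => hJ j (by_contra fun h => hj (hx j h))]
    exact IsHermitian.le_sum_norm_sq_sub (hH θ) hε
      (fun z hz => hc z (mem_symbolRange.2 ⟨θ, hθ, hz⟩)) _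

end Range

/-! ### Counting outliers by compactness -/

section Outliers

open Matrix

variable {r : ℕ} [NeZero r] {F : ℤ × ℤ → Matrix (Fin r) (Fin r) ℂ} {S : Finset (ℤ × ℤ)}

/-- The number of outliers of a compression is at most a constant times the number of indices off
the interior. -/
theorem exists_numOutliers_laurentCompression_le (hF : ∀ k ∉ S, F k = 0)
    (hH : ∀ θ, (trigSymbol F S θ).IsHermitian) {ε : ℝ} (hε : 0 < ε) :
    ∃ K : ℕ, ∀ (ι : Type) [Fintype ι] [DecidableEq ι] (g : ι → (ℤ × ℤ) × Fin r),
      Function.Injective g → (laurentCompression F g).IsHermitian → ∀ J : Finset ι,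
      (∀ j ∈ J, ∀ d ∈ S, ∀ a, ∃ i, g i = ((g j).1 + d, a)) →
      numOutliers (laurentCompression F g) (symbolRange fun θ₁ θ₂ => trigSymbol F S (θ₁, θ₂)) ε ≤
        K * Jᶜ.card := by
  classical
  set R := symbolRange fun θ₁ θ₂ => trigSymbol F S (θ₁, θ₂) with hR
  obtain ⟨m, M, -, -, hb⟩ := exists_extremes_symbolRange (continuous_trigSymbol F S) hH
  have hopen : IsOpen (⋃ w ∈ R, Metric.ball w ε) := isOpen_biUnion fun _ _ => Metric.isOpen_ball
  -- All outliers of all compressions lie in this compact set, which depends only on the symbol and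
  -- `ε`; hence the size of a finite cover is a constant uniform over index sets.
  have hcpt : IsCompact (Icc m M \ Complex.ofReal ⁻¹' (⋃ w ∈ R, Metric.ball w ε)) :=
    isCompact_Icc.diff (hopen.preimage Complex.continuous_ofReal)
  obtain ⟨t, ht, hcov⟩ := hcpt.elim_nhds_subcover (fun c => Metric.ball c ε)
    fun c _ => Metric.ball_mem_nhds c hε
  refine ⟨t.card, fun ι _ _ g hg hM J hJ => ?_⟩
  rw [IsHermitian.numOutliers_eq hM]
  have hsub : (Finset.univ.filter fun i => (hM.eigenvalues i : ℂ) ∉ ⋃ w ∈ R, Metric.ball w ε) ⊆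
      t.biUnion fun c => Finset.univ.filter fun i => |hM.eigenvalues i - c| < ε := by
    intro i hi
    have hi' := (Finset.mem_filter.1 hi).2
    obtain ⟨c, hc, hic⟩ := mem_iUnion₂.1 (hcov
      ⟨eigenvalues_laurentCompression_mem hF hH hg hM hb i, hi'⟩)
    exact Finset.mem_biUnion.2 ⟨c, hc, Finset.mem_filter.2 ⟨Finset.mem_univ _, hic⟩⟩
  refine (Finset.card_le_card hsub).trans (Finset.card_biUnion_le_card_mul _ _ _ fun c hc => ?_)
  refine card_eigenvalues_laurentCompression_near_le hF hH hg hM hJ hε.le fun z hz => ?_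
  -- A centre of the cover is itself outside the `ε`-expansion of the range, hence keeps the
  -- distance `ε` from it.
  by_contra! hlt
  exact (ht c hc).2 (mem_iUnion₂.2 ⟨z, hz, by rwa [Metric.mem_ball, dist_comm]⟩)

end Outliers

/-! ### The symbol of the cubic elements as a trigonometric polynomial -/

section Symbol

open Matrix

/-- The Fourier coefficients of `80 • symbolP3`. -/
def coeffP3 (k : ℤ × ℤ) : Matrix (Fin 9) (Fin 9) ℤ :=
  if k = (0, 0) then
    !![648, -162, 0, -162, 0, 0, 0, 0, 0;
     -162, 540, -135, -108, -162, 27, 27, 27, -6;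
     0, -135, 540, 27, 0, -270, 0, 0, 57;
     -162, -108, 27, 540, -162, 27, -135, 27, -6;
     0, -162, 0, -162, 648, -162, 0, -162, 0;
     0, 27, -270, 27, -162, 540, 0, 0, -105;
     0, 27, 0, -135, 0, 0, 540, -270, 57;
     0, 27, 0, 27, -162, 0, -270, 540, -105;
     0, -6, 57, -6, 0, -105, 57, -105, 272]
  else if k = (1, 0) then
    !![0, 0, -162, 0, 0, 0, 0, 0, 0;
     0, 0, 27, 0, 0, 27, 0, 0, 6;
     0, 0, 0, 0, 0, 0, 0, 0, -3;
     0, 0, 27, 0, 0, -135, 0, 0, 6;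
     0, 0, 0, 0, 0, 0, 0, 0, 0;
     0, 0, 0, 0, 0, 0, 0, 0, -3;
     0, 0, 0, 0, 0, 0, 0, 0, -105;
     0, 0, 0, 0, 0, 0, 0, 0, 57;
     0, 0, 0, 0, 0, 0, 0, 0, -14]
  else if k = (-1, 0) then
    !![0, 0, 0, 0, 0, 0, 0, 0, 0;
     0, 0, 0, 0, 0, 0, 0, 0, 0;
     -162, 27, 0, 27, 0, 0, 0, 0, 0;
     0, 0, 0, 0, 0, 0, 0, 0, 0;
     0, 0, 0, 0, 0, 0, 0, 0, 0;
     0, 27, 0, -135, 0, 0, 0, 0, 0;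
     0, 0, 0, 0, 0, 0, 0, 0, 0;
     0, 0, 0, 0, 0, 0, 0, 0, 0;
     0, 6, -3, 6, 0, -3, -105, 57, -14]
  else if k = (0, 1) then
    !![0, 0, 0, 0, 0, 0, -162, 0, 0;
     0, 0, 0, 0, 0, 0, 27, -135, 6;
     0, 0, 0, 0, 0, 0, 0, 0, -105;
     0, 0, 0, 0, 0, 0, 27, 27, 6;
     0, 0, 0, 0, 0, 0, 0, 0, 0;
     0, 0, 0, 0, 0, 0, 0, 0, 57;
     0, 0, 0, 0, 0, 0, 0, 0, -3;
     0, 0, 0, 0, 0, 0, 0, 0, -3;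
     0, 0, 0, 0, 0, 0, 0, 0, -14]
  else if k = (0, -1) then
    !![0, 0, 0, 0, 0, 0, 0, 0, 0;
     0, 0, 0, 0, 0, 0, 0, 0, 0;
     0, 0, 0, 0, 0, 0, 0, 0, 0;
     0, 0, 0, 0, 0, 0, 0, 0, 0;
     0, 0, 0, 0, 0, 0, 0, 0, 0;
     0, 0, 0, 0, 0, 0, 0, 0, 0;
     -162, 27, 0, 27, 0, 0, 0, 0, 0;
     0, -135, 0, 27, 0, 0, 0, 0, 0;
     0, 6, -105, 6, 0, 57, -3, -3, -14]
  else if k = (1, 1) then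
    !![0, 0, 0, 0, 0, 0, 0, 0, 0;
     0, 0, 0, 0, 0, 0, 0, 0, -6;
     0, 0, 0, 0, 0, 0, 0, 0, 0;
     0, 0, 0, 0, 0, 0, 0, 0, -6;
     0, 0, 0, 0, 0, 0, 0, 0, 0;
     0, 0, 0, 0, 0, 0, 0, 0, 0;
     0, 0, 0, 0, 0, 0, 0, 0, 0;
     0, 0, 0, 0, 0, 0, 0, 0, 0;
     0, 0, 0, 0, 0, 0, 0, 0, 0]
  else if k = (-1, -1) then
    !![0, 0, 0, 0, 0, 0, 0, 0, 0;
     0, 0, 0, 0, 0, 0, 0, 0, 0;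
     0, 0, 0, 0, 0, 0, 0, 0, 0;
     0, 0, 0, 0, 0, 0, 0, 0, 0;
     0, 0, 0, 0, 0, 0, 0, 0, 0;
     0, 0, 0, 0, 0, 0, 0, 0, 0;
     0, 0, 0, 0, 0, 0, 0, 0, 0;
     0, 0, 0, 0, 0, 0, 0, 0, 0;
     0, -6, 0, -6, 0, 0, 0, 0, 0]
  else if k = (1, -1) then
    !![0, 0, 0, 0, 0, 0, 0, 0, 0;
     0, 0, 0, 0, 0, 0, 0, 0, 0;
     0, 0, 0, 0, 0, 0, 0, 0, 0;
     0, 0, 0, 0, 0, 0, 0, 0, 0;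
     0, 0, 0, 0, 0, 0, 0, 0, 0;
     0, 0, 0, 0, 0, 0, 0, 0, 0;
     0, 0, 0, 0, 0, 0, 0, 0, -3;
     0, 0, 0, 0, 0, 0, 0, 0, -3;
     0, 0, -3, 0, 0, -3, 0, 0, 0]
  else if k = (-1, 1) then
    !![0, 0, 0, 0, 0, 0, 0, 0, 0;
     0, 0, 0, 0, 0, 0, 0, 0, 0;
     0, 0, 0, 0, 0, 0, 0, 0, -3;
     0, 0, 0, 0, 0, 0, 0, 0, 0;
     0, 0, 0, 0, 0, 0, 0, 0, 0;
     0, 0, 0, 0, 0, 0, 0, 0, -3;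
     0, 0, 0, 0, 0, 0, 0, 0, 0;
     0, 0, 0, 0, 0, 0, 0, 0, 0;
     0, 0, 0, 0, 0, 0, -3, -3, 0]
  else 0

/-- The Fourier coefficients of `symbolP3`. -/
noncomputable def fourierP3 (k : ℤ × ℤ) : Matrix (Fin 9) (Fin 9) ℂ :=
  Matrix.of fun a b => (coeffP3 k a b : ℂ) / 80

/-- The frequencies of `symbolP3`. -/
def freqP3 : Finset (ℤ × ℤ) := {-1, 0, 1} ×ˢ {-1, 0, 1}

theorem mem_freqP3 {k : ℤ × ℤ} :
    k ∈ freqP3 ↔ (-1 ≤ k.1 ∧ k.1 ≤ 1) ∧ (-1 ≤ k.2 ∧ k.2 ≤ 1) := by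
  simp only [freqP3, Finset.mem_product, Finset.mem_insert, Finset.mem_singleton]
  omega

theorem coeffP3_eq_zero {k : ℤ × ℤ} (hk : k ∉ freqP3) : coeffP3 k = 0 := by
  rw [mem_freqP3] at hk
  unfold coeffP3
  repeat rw [if_neg (by rintro rfl; simp at hk)]

/-- The factor `80` clears all denominators of the symbol, so Hermitian symmetry becomes a decidable
statement about nine integer matrices. -/
theorem coeffP3_neg (k : ℤ × ℤ) : coeffP3 (-k) = (coeffP3 k)ᵀ := by
  by_cases hk : k ∈ freqP3
  · have h : ∀ k ∈ freqP3, coeffP3 (-k) = (coeffP3 k)ᵀ := by decide +kernel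
    exact h k hk
  · rw [coeffP3_eq_zero hk, coeffP3_eq_zero, transpose_zero]
    rw [mem_freqP3] at hk ⊢
    simp only [Prod.fst_neg, Prod.snd_neg]
    omega

theorem fourierP3_eq_zero {k : ℤ × ℤ} (hk : k ∉ freqP3) : fourierP3 k = 0 := by
  ext a b
  simp [fourierP3, coeffP3_eq_zero hk]

theorem fourierP3_neg (k : ℤ × ℤ) : fourierP3 (-k) = (fourierP3 k)ᴴ := by
  ext a b
  simp [fourierP3, coeffP3_neg]

set_option maxHeartbeats 4000000 in
theorem symbolP3_eq_trigSymbol (θ₁ θ₂ : ℝ) :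
    symbolP3 θ₁ θ₂ = trigSymbol fourierP3 freqP3 (θ₁, θ₂) := by
  have hS : freqP3 = {(0, 0), (1, 0), (-1, 0), (0, 1), (0, -1), (1, 1), (-1, -1), (1, -1),
      (-1, 1)} := by decide
  have h1 : star (Complex.exp (Complex.I * θ₁)) = Complex.exp (-(Complex.I * θ₁)) := by
    rw [Complex.star_def, ← Complex.exp_conj]; simp
  have h2 : star (Complex.exp (Complex.I * θ₂)) = Complex.exp (-(Complex.I * θ₂)) := by
    rw [Complex.star_def, ← Complex.exp_conj]; simp
  have h1' : star (Complex.exp (-(Complex.I * θ₁))) = Complex.exp (Complex.I * θ₁) := by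
    rw [← h1, star_star]
  have h2' : star (Complex.exp (-(Complex.I * θ₂))) = Complex.exp (Complex.I * θ₂) := by
    rw [← h2, star_star]
  have hcos : ∀ t : ℝ, ((Real.cos t : ℝ) : ℂ) =
      (Complex.exp (Complex.I * t) + Complex.exp (-(Complex.I * t))) / 2 := fun t => by
    rw [Complex.ofReal_cos, Complex.cos]
    congr 3 <;> ring
  have hch : ∀ k : ℤ × ℤ, torusChar k (θ₁, θ₂) =
      Complex.exp (Complex.I * θ₁) ^ k.1 * Complex.exp (Complex.I * θ₂) ^ k.2 := fun k => by
    rw [torusChar, ← Complex.exp_int_mul, ← Complex.exp_int_mul, ← Complex.exp_add]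
    congr 1
    ring
  have hn : ∀ z : ℂ, Complex.exp z ^ (-1 : ℤ) = Complex.exp (-z) := fun z => by
    rw [_root_.zpow_neg_one, Complex.exp_neg]
  ext a b
  rw [trigSymbol_apply, hS]
  repeat rw [Finset.sum_insert (by decide)]
  rw [Finset.sum_singleton]
  simp only [hch, zpow_zero, zpow_one, hn, one_mul, mul_one, symbolP3, star_mul', star_sub,
    star_add, star_neg, star_one, star_div₀, star_ofNat, h1, h2, h1', h2', hcos]
  -- The relation between an exponential and its conjugate is no longer needed: the 81 entries agree
  -- as polynomials in four independent symbols.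
  generalize Complex.exp (Complex.I * θ₁) = e₁
  generalize Complex.exp (Complex.I * θ₂) = e₂
  generalize Complex.exp (-(Complex.I * θ₁)) = c₁
  generalize Complex.exp (-(Complex.I * θ₂)) = c₂
  simp only [fourierP3, coeffP3, Matrix.of_apply, Prod.mk.injEq, reduceIte, Int.reduceEq,
    Int.reduceNeg, and_false, and_true, and_self, zero_ne_one, one_ne_zero]
  fin_cases a <;> fin_cases b <;>
    simp [-mul_eq_mul_right_iff, -mul_eq_mul_left_iff] <;> ring

end Symbol

/-! ### The cubic shape functions of the reference triangle -/

section Shape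

/-- The coefficients of twice the shape function of the local node `p`; the entry `(i, j)` belongs
to the monomial `s ^ i * t ^ j`. -/
def shapeCoeff (p : ℤ × ℤ) : Matrix (Fin 4) (Fin 4) ℤ :=
  if p = (0, 0) then
    !![2, -11, 18, -9; -11, 36, -27, 0; 18, -27, 0, 0; -9, 0, 0, 0]
  else if p = (0, 1) then
    !![0, 18, -45, 27; 0, -45, 54, 0; 0, 27, 0, 0; 0, 0, 0, 0]
  else if p = (0, 2) then
    !![0, -9, 36, -27; 0, 9, -27, 0; 0, 0, 0, 0; 0, 0, 0, 0]
  else if p = (0, 3) then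
    !![0, 2, -9, 9; 0, 0, 0, 0; 0, 0, 0, 0; 0, 0, 0, 0]
  else if p = (1, 0) then
    !![0, 0, 0, 0; 18, -45, 27, 0; -45, 54, 0, 0; 27, 0, 0, 0]
  else if p = (1, 1) then
    !![0, 0, 0, 0; 0, 54, -54, 0; 0, -54, 0, 0; 0, 0, 0, 0]
  else if p = (1, 2) then
    !![0, 0, 0, 0; 0, -9, 27, 0; 0, 0, 0, 0; 0, 0, 0, 0]
  else if p = (2, 0) then
    !![0, 0, 0, 0; -9, 9, 0, 0; 36, -27, 0, 0; -27, 0, 0, 0]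
  else if p = (2, 1) then
    !![0, 0, 0, 0; 0, -9, 0, 0; 0, 27, 0, 0; 0, 0, 0, 0]
  else if p = (3, 0) then
    !![0, 0, 0, 0; 2, 0, 0, 0; -9, 0, 0, 0; 9, 0, 0, 0]
  else 0

/-- The shape function of the local node `p` on the reference triangle. -/
noncomputable def shape (p : ℤ × ℤ) (z : ℝ × ℝ) : ℝ :=
  ∑ i : Fin 4, ∑ j : Fin 4, (shapeCoeff p i j : ℝ) / 2 * (z.1 ^ (i : ℕ) * z.2 ^ (j : ℕ))

/-- Ties the coefficient table to the barycentric products of `basisFun_lower` and `basisFun_upper`,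
by expanding the ten cases. -/
theorem shape_natCast {k l : ℕ} (hkl : k + l ≤ 3) (z : ℝ × ℝ) :
    shape ((k : ℤ), (l : ℤ)) z = lagrangeFactor (3 - k - l) (1 - z.1 - z.2) *
      lagrangeFactor k z.1 * lagrangeFactor l z.2 := by
  have hk : k ≤ 3 := by omega
  interval_cases k <;> (have hl : l ≤ 3 := by omega) <;> interval_cases l <;>
    first
    | omega
    | (simp [shape, shapeCoeff, Fin.sum_univ_four, lagrangeFactor, Finset.prod_range_succ]
       try ring)

/-- This default lets a node off a triangle be treated like one on it: its shape function there is
zero. -/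
theorem shapeCoeff_eq_zero {p : ℤ × ℤ} (hp : ¬ (0 ≤ p.1 ∧ 0 ≤ p.2 ∧ p.1 + p.2 ≤ 3)) :
    shapeCoeff p = 0 := by
  unfold shapeCoeff
  repeat rw [if_neg (by rintro rfl; simp at hp)]

theorem shape_eq_zero {p : ℤ × ℤ} (hp : ¬ (0 ≤ p.1 ∧ 0 ≤ p.2 ∧ p.1 + p.2 ≤ 3)) (z : ℝ × ℝ) :
    shape p z = 0 := by
  simp [shape, shapeCoeff_eq_zero hp]

theorem hasFDerivAt_monomial (i j : ℕ) (z : ℝ × ℝ) :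
    HasFDerivAt (fun z : ℝ × ℝ => z.1 ^ i * z.2 ^ j)
      ((i * z.1 ^ (i - 1) * z.2 ^ j) • ContinuousLinearMap.fst ℝ ℝ ℝ +
        (j * z.1 ^ i * z.2 ^ (j - 1)) • ContinuousLinearMap.snd ℝ ℝ ℝ) z := by
  have h1 : HasFDerivAt (fun z : ℝ × ℝ => z.1 ^ i) _ z :=
    (hasFDerivAt_fst (𝕜 := ℝ) (E := ℝ) (F := ℝ) (p := z)).pow i
  have h2 : HasFDerivAt (fun z : ℝ × ℝ => z.2 ^ j) _ z :=
    (hasFDerivAt_snd (𝕜 := ℝ) (E := ℝ) (F := ℝ) (p := z)).pow j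
  refine (h1.mul h2).congr_fderiv ?_
  ext <;> simp <;> ring

theorem hasFDerivAt_shape (p : ℤ × ℤ) (z : ℝ × ℝ) :
    HasFDerivAt (shape p) (∑ i : Fin 4, ∑ j : Fin 4, ((shapeCoeff p i j : ℝ) / 2) •
      (((i : ℕ) * z.1 ^ ((i : ℕ) - 1) * z.2 ^ (j : ℕ)) • ContinuousLinearMap.fst ℝ ℝ ℝ +
        ((j : ℕ) * z.1 ^ (i : ℕ) * z.2 ^ ((j : ℕ) - 1)) • ContinuousLinearMap.snd ℝ ℝ ℝ)) z := by
  unfold shape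
  refine HasFDerivAt.fun_sum fun i _ => HasFDerivAt.fun_sum fun j _ => ?_
  exact (hasFDerivAt_monomial i j z).const_mul _

/-- The truncated subtractions in the exponents are harmless, since the factor in front vanishes
whenever a lowered exponent is `0`. -/
theorem gradDot_shape (p q : ℤ × ℤ) (z : ℝ × ℝ) :
    gradDot (shape p) (shape q) z =
      ∑ i : Fin 4, ∑ j : Fin 4, ∑ k : Fin 4, ∑ l : Fin 4,
        (shapeCoeff p i j * shapeCoeff q k l : ℝ) / 4 *
        (((i : ℕ) * (k : ℕ)) * (z.1 ^ ((i : ℕ) - 1 + ((k : ℕ) - 1)) * z.2 ^ ((j : ℕ) + (l : ℕ))) +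
          ((j : ℕ) * (l : ℕ)) *
            (z.1 ^ ((i : ℕ) + (k : ℕ)) * z.2 ^ ((j : ℕ) - 1 + ((l : ℕ) - 1)))) := by
  rw [gradDot, mul_comm (fderiv ℝ (shape p) z (1, 0)), mul_comm (fderiv ℝ (shape p) z (0, 1)),
    (hasFDerivAt_shape p z).fderiv, (hasFDerivAt_shape q z).fderiv]
  simp only [_root_.sum_apply, _root_.smul_apply, _root_.add_apply,
    ContinuousLinearMap.coe_fst', ContinuousLinearMap.coe_snd',
    smul_eq_mul, mul_one, mul_zero, add_zero, zero_add, Finset.sum_mul, Finset.mul_sum,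
    ← Finset.sum_add_distrib]
  refine Finset.sum_congr rfl fun i _ => Finset.sum_congr rfl fun j _ =>
    Finset.sum_congr rfl fun k _ => Finset.sum_congr rfl fun l _ => ?_
  ring

theorem continuous_gradDot_shape (p q : ℤ × ℤ) : Continuous (gradDot (shape p) (shape q)) := by
  rw [funext (gradDot_shape p q)]
  fun_prop

end Shape

/-! ### Moments of the reference triangle -/

section Moments

/-- The open reference triangle. -/
def refTriangle : Set (ℝ × ℝ) := {z | 0 < z.1 ∧ 0 < z.2 ∧ z.1 + z.2 < 1}

theorem isOpen_refTriangle : IsOpen refTriangle :=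
  (isOpen_lt continuous_const continuous_fst).inter
    ((isOpen_lt continuous_const continuous_snd).inter
      (isOpen_lt (continuous_fst.add continuous_snd) continuous_const))

theorem refTriangle_subset : refTriangle ⊆ Icc 0 1 ×ˢ Icc 0 1 := by
  rintro z ⟨h1, h2, h3⟩
  exact ⟨⟨by linarith, by linarith⟩, by linarith, by linarith⟩

theorem integrableOn_refTriangle {f : ℝ × ℝ → ℝ} (hf : Continuous f) :
    IntegrableOn f refTriangle :=
  (hf.continuousOn.integrableOn_compact (isCompact_Icc.prod isCompact_Icc)).mono_set
    refTriangle_subset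

/-- Euler's beta integral. Expanding one factor `1 - s` lowers `m` but raises `a` in one term, so
the induction runs over all `a`. -/
theorem integral_pow_mul_one_sub_pow (a m : ℕ) :
    ∫ s in (0 : ℝ)..1, s ^ a * (1 - s) ^ m =
      (a.factorial * m.factorial : ℝ) / (a + m + 1).factorial := by
  induction m generalizing a with
  | zero =>
    simp only [pow_zero, mul_one, integral_pow, Nat.factorial]
    push_cast
    have := Nat.cast_ne_zero (R := ℝ).2 a.factorial_ne_zero
    field_simp
    simp
  | succ m ih =>
    have h : ∀ s : ℝ, s ^ a * (1 - s) ^ (m + 1) =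
        s ^ a * (1 - s) ^ m - s ^ (a + 1) * (1 - s) ^ m := fun s => by ring
    simp only [h]
    rw [intervalIntegral.integral_sub
      ((by fun_prop : Continuous fun s : ℝ => s ^ a * (1 - s) ^ m).intervalIntegrable _ _)
      ((by fun_prop : Continuous fun s : ℝ => s ^ (a + 1) * (1 - s) ^ m).intervalIntegrable _ _),
      ih, ih]
    have e1 : a + 1 + m + 1 = a + m + 1 + 1 := by ring
    have e2 : a + (m + 1) + 1 = a + m + 1 + 1 := by ring
    rw [e1, e2, Nat.factorial_succ (a + m + 1), Nat.factorial_succ a, Nat.factorial_succ m]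
    have := Nat.cast_ne_zero (R := ℝ).2 (a + m + 1).factorial_ne_zero
    push_cast
    have : (a : ℝ) + m + 1 + 1 ≠ 0 := by positivity
    field_simp
    ring

/-- Dirichlet's formula: by Fubini the inner integral over `0 < t < 1 - s` leaves a beta integral in
`s`. -/
theorem integral_refTriangle_monomial (a b : ℕ) :
    ∫ z in refTriangle, z.1 ^ a * z.2 ^ b =
      (a.factorial * b.factorial : ℝ) / (a + b + 2).factorial := by
  classical
  have hm : MeasurableSet refTriangle := isOpen_refTriangle.measurableSet
  have hc : Continuous fun z : ℝ × ℝ => z.1 ^ a * z.2 ^ b := by fun_prop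
  rw [← integral_indicator hm, Measure.volume_eq_prod, integral_prod _
    ((integrable_indicator_iff hm).2 (integrableOn_refTriangle hc))]
  have hin : ∀ s : ℝ, ∫ t, refTriangle.indicator (fun z : ℝ × ℝ => z.1 ^ a * z.2 ^ b) (s, t) =
      (Ioc (0 : ℝ) 1).indicator (fun s => s ^ a * (1 - s) ^ (b + 1) / (b + 1)) s := by
    intro s
    by_cases hs : s ∈ Ioc (0 : ℝ) 1
    · have : ∀ t, refTriangle.indicator (fun z : ℝ × ℝ => z.1 ^ a * z.2 ^ b) (s, t) =
          (Ioo 0 (1 - s)).indicator (fun t => s ^ a * t ^ b) t := by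
        intro t
        simp only [indicator_apply]
        refine if_congr ?_ rfl rfl
        exact ⟨fun h => ⟨h.2.1, by have := h.2.2; simp only at this; linarith⟩,
          fun h => ⟨hs.1, h.1, by have := h.2; simp only; linarith⟩⟩
      simp only [this]
      rw [integral_indicator measurableSet_Ioo, ← integral_Ioc_eq_integral_Ioo,
        ← intervalIntegral.integral_of_le (by linarith [hs.2]),
        intervalIntegral.integral_const_mul, integral_pow, indicator_of_mem hs]
      simp
      ring
    · have : ∀ t, refTriangle.indicator (fun z : ℝ × ℝ => z.1 ^ a * z.2 ^ b) (s, t) = 0 := by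
        intro t
        refine indicator_of_notMem (fun h => hs ⟨h.1, ?_⟩) _
        have h1 := h.2.1
        have h2 := h.2.2
        simp only at h1 h2
        linarith
      simp [this, indicator_of_notMem hs]
  simp only [hin]
  rw [integral_indicator measurableSet_Ioc, ← intervalIntegral.integral_of_le zero_le_one,
    intervalIntegral.integral_div, integral_pow_mul_one_sub_pow, Nat.factorial_succ b]
  have : (b : ℝ) + 1 ≠ 0 := by positivity
  push_cast
  have e : a + (b + 1) + 1 = a + b + 2 := by ring
  rw [e]
  field_simp

/-- The moments of the reference triangle, multiplied by `12!`. -/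
def scaledMoment (a b : ℕ) : ℕ :=
  a.factorial * b.factorial * (Nat.factorial 12 / (a + b + 2).factorial)

/-- With four indices at most `3`, the exponents in `gradDot_shape` add up to at most `2 + 2 + 6 =
10`, so `12!` is a common denominator. -/
theorem integral_refTriangle_monomial_eq_scaledMoment {a b : ℕ} (h : a + b ≤ 10) :
    ∫ z in refTriangle, z.1 ^ a * z.2 ^ b = (scaledMoment a b : ℝ) / Nat.factorial 12 := by
  rw [integral_refTriangle_monomial, scaledMoment]
  have h1 : (a + b + 2).factorial ∣ Nat.factorial 12 := Nat.factorial_dvd_factorial (by omega)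
  have h2 := Nat.cast_ne_zero (R := ℝ).2 (a + b + 2).factorial_ne_zero
  have h3 := Nat.cast_ne_zero (R := ℝ).2 (Nat.factorial_ne_zero 12)
  rw [Nat.cast_mul, Nat.cast_mul, Nat.cast_div h1 h2]
  field_simp

end Moments

/-! ### The stiffness matrix of the reference triangle -/

section LocalStiffness

/-- Position of a local node in the table `localStiffnessTable`. -/
def localIndex (p : ℤ × ℤ) : ℕ := (p.1 * (9 - p.1) / 2 + p.2).toNat

/-- The entries of the stiffness matrix of the reference triangle, multiplied by `80`. -/
def localStiffnessTable : List (List ℤ) :=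
  [[68, -51, 30, -7, -51, 0, -6, 30, -6, -7],
   [-51, 270, -135, 27, 0, -162, 27, 0, 27, -3],
   [30, -135, 270, -54, 0, 0, -135, 0, 27, -3],
   [-7, 27, -54, 34, -3, 0, 3, -3, 3, 0],
   [-51, 0, 0, -3, 270, -162, 27, -135, 27, 27],
   [0, -162, 0, 0, -162, 648, -162, 0, -162, 0],
   [-6, 27, -135, 3, 27, -162, 270, 27, -54, 3],
   [30, 0, 0, -3, -135, 0, 27, 270, -135, -54],
   [-6, 27, 27, 3, 27, -162, -54, -135, 270, 3],
   [-7, -3, -3, 0, 27, 0, 3, -54, 3, 34]]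

/-- The stiffness of two local nodes, multiplied by `80`; it is zero off the triangle. -/
def localStiffness (p q : ℤ × ℤ) : ℤ :=
  if (0 ≤ p.1 ∧ 0 ≤ p.2 ∧ p.1 + p.2 ≤ 3) ∧ (0 ≤ q.1 ∧ 0 ≤ q.2 ∧ q.1 + q.2 ≤ 3) then
    (localStiffnessTable.getD (localIndex p) []).getD (localIndex q) 0
  else 0

/-- The local nodes of the reference triangle. -/
def localNodes : Finset (ℤ × ℤ) :=
  {(0, 0), (0, 1), (0, 2), (0, 3), (1, 0), (1, 1), (1, 2), (2, 0), (2, 1), (3, 0)}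

theorem mem_localNodes {p : ℤ × ℤ} :
    p ∈ localNodes ↔ 0 ≤ p.1 ∧ 0 ≤ p.2 ∧ p.1 + p.2 ≤ 3 := by
  simp only [localNodes, Finset.mem_insert, Finset.mem_singleton, Prod.ext_iff]
  omega

/-- The quadrature of the products of gradients, multiplied by `4 * 12!`. -/
def scaledStiffness (p q : ℤ × ℤ) : ℤ :=
  ∑ i : Fin 4, ∑ j : Fin 4, ∑ k : Fin 4, ∑ l : Fin 4, shapeCoeff p i j * shapeCoeff q k l *
    (((i : ℕ) * (k : ℕ)) * scaledMoment ((i : ℕ) - 1 + ((k : ℕ) - 1)) ((j : ℕ) + (l : ℕ)) +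
      ((j : ℕ) * (l : ℕ)) * scaledMoment ((i : ℕ) + (k : ℕ)) ((j : ℕ) - 1 + ((l : ℕ) - 1)))

/-- The integral is scaled by `4 * 12!` on one side and by `80` on the other, whence the factor
`20`. On the triangle these are 100 integer identities. -/
theorem scaledStiffness_eq (p q : ℤ × ℤ) :
    20 * scaledStiffness p q = Nat.factorial 12 * localStiffness p q := by
  by_cases hp : 0 ≤ p.1 ∧ 0 ≤ p.2 ∧ p.1 + p.2 ≤ 3
  · by_cases hq : 0 ≤ q.1 ∧ 0 ≤ q.2 ∧ q.1 + q.2 ≤ 3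
    · have h : ∀ p ∈ localNodes, ∀ q ∈ localNodes,
          20 * scaledStiffness p q = Nat.factorial 12 * localStiffness p q := by decide +kernel
      exact h p (mem_localNodes.2 hp) q (mem_localNodes.2 hq)
    · simp [scaledStiffness, localStiffness, hq, shapeCoeff_eq_zero hq]
  · simp [scaledStiffness, localStiffness, hp, shapeCoeff_eq_zero hp]

theorem integral_gradDot_shape (p q : ℤ × ℤ) :
    ∫ z in refTriangle, gradDot (shape p) (shape q) z = (localStiffness p q : ℝ) / 80 := by
  have h3 := Nat.cast_ne_zero (R := ℝ).2 (Nat.factorial_ne_zero 12)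
  have h : ∫ z in refTriangle, gradDot (shape p) (shape q) z =
      (scaledStiffness p q : ℝ) / (4 * Nat.factorial 12) := by
    simp only [gradDot_shape]
    rw [scaledStiffness]
    push_cast
    rw [integral_finsetSum _ fun i _ => integrableOn_refTriangle (by fun_prop), Finset.sum_div]
    refine Finset.sum_congr rfl fun i _ => ?_
    rw [integral_finsetSum _ fun i _ => integrableOn_refTriangle (by fun_prop), Finset.sum_div]
    refine Finset.sum_congr rfl fun j _ => ?_
    rw [integral_finsetSum _ fun i _ => integrableOn_refTriangle (by fun_prop), Finset.sum_div]
    refine Finset.sum_congr rfl fun k _ => ?_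
    rw [integral_finsetSum _ fun i _ => integrableOn_refTriangle (by fun_prop), Finset.sum_div]
    refine Finset.sum_congr rfl fun l _ => ?_
    rw [integral_const_mul, integral_add (integrableOn_refTriangle (by fun_prop))
      (integrableOn_refTriangle (by fun_prop)), integral_const_mul, integral_const_mul,
      integral_refTriangle_monomial_eq_scaledMoment (by omega),
      integral_refTriangle_monomial_eq_scaledMoment (by omega)]
    field_simp
  rw [h, div_eq_div_iff (by positivity) (by norm_num)]
  have e := congrArg (fun t : ℤ => (t : ℝ)) (scaledStiffness_eq p q)
  simp only [Int.cast_mul, Int.cast_natCast, Int.cast_ofNat] at e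
  linarith

end LocalStiffness

/-! ### Decomposition of the square into the open triangles of the mesh -/

section Mesh

/-- The affine map that takes the triangle `κ = (a, b, σ)` of the mesh to the reference triangle;
the triangle is an upper one if `σ` is true. -/
noncomputable def cellMap (n : ℕ) (κ : (ℕ × ℕ) × Bool) (z : ℝ × ℝ) : ℝ × ℝ :=
  (if κ.2 then -(n : ℝ) else n) • z +
    if κ.2 then ((κ.1.1 : ℝ) + 1, (κ.1.2 : ℝ) + 1) else (-(κ.1.1 : ℝ), -(κ.1.2 : ℝ))

/-- The open triangle `κ` of the mesh. -/
def openCell (n : ℕ) (κ : (ℕ × ℕ) × Bool) : Set (ℝ × ℝ) := cellMap n κ ⁻¹' refTriangle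

/-- The local coordinates, with respect to the triangle `κ`, of the node `m`. -/
def localNode (κ : (ℕ × ℕ) × Bool) (m : ℕ × ℕ) : ℤ × ℤ :=
  if κ.2 then (3 - ((m.1 : ℤ) - 3 * κ.1.1), 3 - ((m.2 : ℤ) - 3 * κ.1.2))
  else ((m.1 : ℤ) - 3 * κ.1.1, (m.2 : ℤ) - 3 * κ.1.2)

/-- The indices of the triangles of the mesh. -/
def meshCells (n : ℕ) : Finset ((ℕ × ℕ) × Bool) :=
  (Finset.range n ×ˢ Finset.range n) ×ˢ Finset.univ

theorem continuous_cellMap (n : ℕ) (κ : (ℕ × ℕ) × Bool) : Continuous (cellMap n κ) := by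
  unfold cellMap
  fun_prop

theorem isOpen_openCell (n : ℕ) (κ : (ℕ × ℕ) × Bool) : IsOpen (openCell n κ) :=
  isOpen_refTriangle.preimage (continuous_cellMap n κ)

theorem mem_openCell_false {n a b : ℕ} {z : ℝ × ℝ} : z ∈ openCell n ((a, b), false) ↔
    (a : ℝ) < n * z.1 ∧ (b : ℝ) < n * z.2 ∧ n * z.1 + n * z.2 < a + b + 1 := by
  simp only [openCell, refTriangle, cellMap, mem_preimage, mem_ofPred_eq, Bool.false_eq_true,
    if_false, Prod.fst_add, Prod.snd_add, Prod.smul_fst, Prod.smul_snd, smul_eq_mul]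
  constructor <;> rintro ⟨h1, h2, h3⟩ <;> refine ⟨?_, ?_, ?_⟩ <;> linarith

theorem mem_openCell_true {n a b : ℕ} {z : ℝ × ℝ} : z ∈ openCell n ((a, b), true) ↔
    n * z.1 < (a : ℝ) + 1 ∧ n * z.2 < (b : ℝ) + 1 ∧ (a : ℝ) + b + 1 < n * z.1 + n * z.2 := by
  simp only [openCell, refTriangle, cellMap, mem_preimage, mem_ofPred_eq,
    if_true, Prod.fst_add, Prod.snd_add, Prod.smul_fst, Prod.smul_snd, smul_eq_mul]
  constructor <;> rintro ⟨h1, h2, h3⟩ <;> refine ⟨?_, ?_, ?_⟩ <;> linarith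

/-- An open triangle determines its square. -/
theorem bounds_of_mem_openCell {n : ℕ} {κ : (ℕ × ℕ) × Bool} {z : ℝ × ℝ} (hz : z ∈ openCell n κ) :
    ((κ.1.1 : ℝ) < n * z.1 ∧ n * z.1 < κ.1.1 + 1) ∧
      ((κ.1.2 : ℝ) < n * z.2 ∧ n * z.2 < κ.1.2 + 1) := by
  obtain ⟨⟨a, b⟩, σ⟩ := κ
  cases σ
  · obtain ⟨h1, h2, h3⟩ := mem_openCell_false.1 hz
    exact ⟨⟨h1, by simp only; linarith⟩, h2, by simp only; linarith⟩
  · obtain ⟨h1, h2, h3⟩ := mem_openCell_true.1 hz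
    exact ⟨⟨by simp only; linarith, h1⟩, by simp only; linarith, h2⟩

theorem natCast_eq_of_lt_add_one {a b : ℕ} {t : ℝ} (ha : (a : ℝ) < t) (ha' : t < a + 1)
    (hb : (b : ℝ) < t) (hb' : t < b + 1) : a = b := by
  have h1 : (a : ℝ) < (b + 1 : ℕ) := by push_cast; linarith
  have h2 : (b : ℝ) < (a + 1 : ℕ) := by push_cast; linarith
  rw [Nat.cast_lt] at h1 h2
  omega

/-- A point of an open triangle determines the square through the integer parts of `n * z`, and the
kind of triangle through its side of the diagonal. -/
theorem disjoint_openCell {n : ℕ} {κ κ' : (ℕ × ℕ) × Bool} (h : κ ≠ κ') :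
    Disjoint (openCell n κ) (openCell n κ') := by
  rw [Set.disjoint_left]
  intro z hz hz'
  refine h ?_
  obtain ⟨⟨h1, h2⟩, h3, h4⟩ := bounds_of_mem_openCell hz
  obtain ⟨⟨h1', h2'⟩, h3', h4'⟩ := bounds_of_mem_openCell hz'
  obtain ⟨⟨a, b⟩, σ⟩ := κ
  obtain ⟨⟨a', b'⟩, σ'⟩ := κ'
  obtain rfl : a = a' := natCast_eq_of_lt_add_one h1 h2 h1' h2'
  obtain rfl : b = b' := natCast_eq_of_lt_add_one h3 h4 h3' h4'
  cases σ <;> cases σ' <;> try rfl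
  · have := (mem_openCell_false.1 hz).2.2
    have := (mem_openCell_true.1 hz').2.2
    linarith
  · have := (mem_openCell_false.1 hz').2.2
    have := (mem_openCell_true.1 hz).2.2
    linarith

theorem openCell_subset_unitSquare {n : ℕ} {κ : (ℕ × ℕ) × Bool} (hκ : κ ∈ meshCells n) :
    openCell n κ ⊆ unitSquare := by
  intro z hz
  simp only [meshCells, Finset.mem_product, Finset.mem_range, Finset.mem_univ, and_true] at hκ
  obtain ⟨⟨h1, h2⟩, h3, h4⟩ := bounds_of_mem_openCell hz
  have hn : (0 : ℝ) < n := by exact_mod_cast (by omega : 0 < n)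
  have ha : (κ.1.1 : ℝ) + 1 ≤ n := by exact_mod_cast hκ.1
  have hb : (κ.1.2 : ℝ) + 1 ≤ n := by exact_mod_cast hκ.2
  refine ⟨⟨?_, ?_⟩, ?_, ?_⟩
  · exact pos_of_mul_pos_right (lt_of_le_of_lt (Nat.cast_nonneg _) h1) hn.le
  · exact lt_of_mul_lt_mul_left (by linarith) hn.le
  · exact pos_of_mul_pos_right (lt_of_le_of_lt (Nat.cast_nonneg _) h3) hn.le
  · exact lt_of_mul_lt_mul_left (by linarith) hn.le

theorem ae_fst_ne (c : ℝ) : ∀ᵐ z : ℝ × ℝ, z.1 ≠ c :=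
  Measure.quasiMeasurePreserving_fst.ae (Measure.ae_ne volume c)

theorem ae_snd_ne (c : ℝ) : ∀ᵐ z : ℝ × ℝ, z.2 ≠ c :=
  Measure.quasiMeasurePreserving_snd.ae (Measure.ae_ne volume c)

/-- The measure-preserving shear `(x, y) ↦ (x, x + y)` carries the diagonal line to a horizontal
one. -/
theorem ae_add_ne (c : ℝ) : ∀ᵐ z : ℝ × ℝ, z.1 + z.2 ≠ c :=
  (measurePreserving_prod_add (volume : Measure ℝ) (volume : Measure ℝ)).quasiMeasurePreserving.ae
    (ae_snd_ne c)

/-- Up to a null set the open triangles of the mesh fill the square. -/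
theorem unitSquare_ae_eq {n : ℕ} (hn : 1 ≤ n) :
    unitSquare =ᵐ[volume] ⋃ κ ∈ meshCells n, openCell n κ := by
  have hn' : (0 : ℝ) < n := by exact_mod_cast hn
  -- Off these countably many lines, which contain all edges of the mesh, the integer parts of `n *
  -- z` and the side of the diagonal select an open triangle.
  have h1 : ∀ᵐ z : ℝ × ℝ, ∀ k : ℕ, z.1 ≠ k / n := ae_all_iff.2 fun k => ae_fst_ne _
  have h2 : ∀ᵐ z : ℝ × ℝ, ∀ k : ℕ, z.2 ≠ k / n := ae_all_iff.2 fun k => ae_snd_ne _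
  have h3 : ∀ᵐ z : ℝ × ℝ, ∀ k : ℕ, z.1 + z.2 ≠ k / n := ae_all_iff.2 fun k => ae_add_ne _
  filter_upwards [h1, h2, h3] with z h1 h2 h3
  refine propext ⟨fun hz => ?_, fun hz => ?_⟩
  · obtain ⟨⟨hx0, hx1⟩, hy0, hy1⟩ := hz
    have hx : 0 ≤ n * z.1 := by positivity
    have hy : 0 ≤ n * z.2 := by positivity
    have ha := lt_of_le_of_ne (Nat.floor_le hx) fun h => h1 ⌊n * z.1⌋₊ (by rw [h]; field_simp)
    have hb := lt_of_le_of_ne (Nat.floor_le hy) fun h => h2 ⌊n * z.2⌋₊ (by rw [h]; field_simp)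
    have ha' := Nat.lt_floor_add_one (n * z.1)
    have hb' := Nat.lt_floor_add_one (n * z.2)
    have han : ⌊n * z.1⌋₊ < n := (Nat.floor_lt hx).2 (by nlinarith)
    have hbn : ⌊n * z.2⌋₊ < n := (Nat.floor_lt hy).2 (by nlinarith)
    have hs : (n * z.1 + n * z.2 : ℝ) ≠ ⌊n * z.1⌋₊ + ⌊n * z.2⌋₊ + 1 := by
      intro h
      refine h3 (⌊n * z.1⌋₊ + ⌊n * z.2⌋₊ + 1) ?_
      push_cast
      rw [← h]
      field_simp
    rcases lt_or_gt_of_ne hs with hs | hs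
    · exact mem_iUnion₂.2 ⟨((⌊n * z.1⌋₊, ⌊n * z.2⌋₊), false), by simp [meshCells, han, hbn],
        mem_openCell_false.2 ⟨ha, hb, hs⟩⟩
    · exact mem_iUnion₂.2 ⟨((⌊n * z.1⌋₊, ⌊n * z.2⌋₊), true), by simp [meshCells, han, hbn],
        mem_openCell_true.2 ⟨ha', hb', hs⟩⟩
  · obtain ⟨κ, hκ, h⟩ := mem_iUnion₂.1 hz
    exact openCell_subset_unitSquare hκ h

/-! ### The entries of the stiffness matrix -/

/-- On a triangle of the mesh a basis function is a shape function in local coordinates. -/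
theorem basisFun_eq_shape {n : ℕ} {m : ℕ × ℕ} (h1 : m.1 < 3 * n) (h2 : m.2 < 3 * n)
    {κ : (ℕ × ℕ) × Bool} (hκ : κ ∈ meshCells n) {z : ℝ × ℝ} (hz : z ∈ openCell n κ) :
    basisFun n m z = shape (localNode κ m) (cellMap n κ z) := by
  obtain ⟨⟨a, b⟩, σ⟩ := κ
  simp only [meshCells, Finset.mem_product, Finset.mem_range, Finset.mem_univ, and_true] at hκ
  cases σ
  · obtain ⟨z1, z2, z3⟩ := mem_openCell_false.1 hz
    have hz' : z ∈ lowerTriangle n a b := ⟨z1.le, z2.le, z3.le⟩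
    by_cases h : 3 * a ≤ m.1 ∧ 3 * b ≤ m.2 ∧ m.1 + m.2 ≤ 3 * a + 3 * b + 3
    · obtain ⟨k, hk⟩ := Nat.exists_eq_add_of_le h.1
      obtain ⟨l, hl⟩ := Nat.exists_eq_add_of_le h.2.1
      obtain rfl : m = (3 * a + k, 3 * b + l) := Prod.ext hk hl
      have hkl : k + l ≤ 3 := by simp only at h; omega
      have e : localNode ((a, b), false) (3 * a + k, 3 * b + l) = ((k : ℤ), (l : ℤ)) := by
        simp [localNode]
      rw [basisFun_lower hκ.1 hκ.2 hkl hz', e, shape_natCast hkl]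
      simp only [cellMap, Bool.false_eq_true, if_false, Prod.fst_add, Prod.snd_add, Prod.smul_fst,
        Prod.smul_snd, smul_eq_mul, ← sub_eq_add_neg]
    · rw [basisFun_lower_zero h1 h2 h hz', shape_eq_zero]
      simp only [localNode, Bool.false_eq_true, if_false]
      omega
  · obtain ⟨z1, z2, z3⟩ := mem_openCell_true.1 hz
    have hz' : z ∈ upperTriangle n a b := ⟨z1.le, z2.le, z3.le⟩
    by_cases h : m.1 ≤ 3 * a + 3 ∧ m.2 ≤ 3 * b + 3 ∧ 3 * a + 3 * b + 3 ≤ m.1 + m.2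
    · obtain ⟨k, hk⟩ := Nat.exists_eq_add_of_le (show 3 * a ≤ m.1 by omega)
      obtain ⟨l, hl⟩ := Nat.exists_eq_add_of_le (show 3 * b ≤ m.2 by omega)
      obtain rfl : m = (3 * a + k, 3 * b + l) := Prod.ext hk hl
      simp only at h
      have e : localNode ((a, b), true) (3 * a + k, 3 * b + l) =
          (((3 - k : ℕ) : ℤ), ((3 - l : ℕ) : ℤ)) := by
        simp only [localNode, if_true, Prod.mk.injEq]
        omega
      rw [basisFun_upper hκ.1 hκ.2 (by omega) (by omega) (by omega) hz', e,
        shape_natCast (by omega), (by omega : 3 - (3 - k) - (3 - l) = k + l - 3)]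
      have c1 : (cellMap n ((a, b), true) z).1 = a + 1 - n * z.1 := by simp [cellMap]; ring
      have c2 : (cellMap n ((a, b), true) z).2 = b + 1 - n * z.2 := by simp [cellMap]; ring
      rw [c1, c2]
    · rw [basisFun_upper_zero h1 h2 h hz', shape_eq_zero]
      simp only [localNode, if_true]
      omega

/-- Chain rule: each gradient gains a factor `ν`. The sign of `ν` drops out, so lower and upper
triangles share one element matrix. -/
theorem gradDot_comp_affine {φ ψ : ℝ × ℝ → ℝ} (hφ : Differentiable ℝ φ) (hψ : Differentiable ℝ ψ)
    (ν : ℝ) (c z : ℝ × ℝ) :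
    gradDot (fun z => φ (ν • z + c)) (fun z => ψ (ν • z + c)) z =
      ν ^ 2 * gradDot φ ψ (ν • z + c) := by
  have h : ∀ {χ : ℝ × ℝ → ℝ}, Differentiable ℝ χ → ∀ v,
      fderiv ℝ (fun z => χ (ν • z + c)) z v = ν * fderiv ℝ χ (ν • z + c) v := by
    intro χ hχ v
    have h1 : HasFDerivAt (fun z : ℝ × ℝ => ν • z + c) (ν • ContinuousLinearMap.id ℝ (ℝ × ℝ)) z :=
      ((hasFDerivAt_id z).const_smul ν).add_const c
    have h2 := (hχ (ν • z + c)).hasFDerivAt.comp z h1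
    have h3 : fderiv ℝ (fun z => χ (ν • z + c)) z = _ := h2.fderiv
    rw [h3]
    simp
  rw [gradDot, gradDot, h hφ, h hφ, h hψ, h hψ]
  ring

theorem differentiable_shape (p : ℤ × ℤ) : Differentiable ℝ (shape p) :=
  fun z => (hasFDerivAt_shape p z).differentiableAt

/-- Derivatives are local and the cell is open, so the equality with a shape function on the cell
passes to gradients, although basis functions need not be differentiable across edges. -/
theorem gradDot_basisFun {n : ℕ} {m m' : ℕ × ℕ} (h1 : m.1 < 3 * n) (h2 : m.2 < 3 * n)
    (h1' : m'.1 < 3 * n) (h2' : m'.2 < 3 * n) {κ : (ℕ × ℕ) × Bool} (hκ : κ ∈ meshCells n)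
    {z : ℝ × ℝ} (hz : z ∈ openCell n κ) :
    gradDot (basisFun n m) (basisFun n m') z =
      (n : ℝ) ^ 2 * gradDot (shape (localNode κ m)) (shape (localNode κ m')) (cellMap n κ z) := by
  have hnhds := (isOpen_openCell n κ).mem_nhds hz
  have e : ∀ {m : ℕ × ℕ}, m.1 < 3 * n → m.2 < 3 * n → fderiv ℝ (basisFun n m) z =
      fderiv ℝ (fun z => shape (localNode κ m) (cellMap n κ z)) z := fun h1 h2 =>
    Filter.EventuallyEq.fderiv_eq (Filter.mem_of_superset hnhds fun w hw =>
      basisFun_eq_shape h1 h2 hκ hw)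
  have h := gradDot_comp_affine (differentiable_shape (localNode κ m))
    (differentiable_shape (localNode κ m')) (if κ.2 then -(n : ℝ) else n)
    (if κ.2 then ((κ.1.1 : ℝ) + 1, (κ.1.2 : ℝ) + 1) else (-(κ.1.1 : ℝ), -(κ.1.2 : ℝ))) z
  have hsq : (if κ.2 then -(n : ℝ) else n) ^ 2 = (n : ℝ) ^ 2 := by split_ifs <;> ring
  rw [hsq] at h
  rw [gradDot, e h1 h2, e h1' h2']
  exact h

/-- In dimension two the Jacobian of the homothety cancels the factor `ν ^ 2` of the gradients.
Hence the stiffness entries do not depend on the mesh size. -/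
theorem setIntegral_preimage_affine (G : ℝ × ℝ → ℝ) {T : Set (ℝ × ℝ)} (hT : MeasurableSet T)
    {ν : ℝ} (hν : ν ≠ 0) (c : ℝ × ℝ) :
    ∫ z in (fun z => ν • z + c) ⁻¹' T, ν ^ 2 * G (ν • z + c) = ∫ z in T, G z := by
  have hm : MeasurableSet ((fun z : ℝ × ℝ => ν • z + c) ⁻¹' T) :=
    hT.preimage (by fun_prop)
  rw [← integral_indicator hm, ← integral_indicator hT]
  have e : ∀ z : ℝ × ℝ, ((fun z : ℝ × ℝ => ν • z + c) ⁻¹' T).indicator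
      (fun z => ν ^ 2 * G (ν • z + c)) z = ν ^ 2 * (fun w => T.indicator G (w + c)) (ν • z) := by
    intro z
    by_cases hz : ν • z + c ∈ T
    · rw [indicator_of_mem (show z ∈ (fun z : ℝ × ℝ => ν • z + c) ⁻¹' T from hz)]
      simp only [indicator_of_mem hz]
    · rw [indicator_of_notMem (show z ∉ (fun z : ℝ × ℝ => ν • z + c) ⁻¹' T from hz)]
      simp only [indicator_of_notMem hz, mul_zero]
  simp only [e]
  rw [integral_const_mul, Measure.integral_comp_smul volume (fun w => T.indicator G (w + c)),
    integral_add_right_eq_self (T.indicator G)]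
  have hd : Module.finrank ℝ (ℝ × ℝ) = 2 := by simp
  rw [hd, smul_eq_mul, abs_of_nonneg (by positivity)]
  field_simp

theorem integral_openCell {n : ℕ} (hn : 1 ≤ n) {m m' : ℕ × ℕ} (h1 : m.1 < 3 * n)
    (h2 : m.2 < 3 * n) (h1' : m'.1 < 3 * n) (h2' : m'.2 < 3 * n) {κ : (ℕ × ℕ) × Bool}
    (hκ : κ ∈ meshCells n) :
    ∫ z in openCell n κ, gradDot (basisFun n m) (basisFun n m') z =
      (localStiffness (localNode κ m) (localNode κ m') : ℝ) / 80 := by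
  have hn' : (n : ℝ) ≠ 0 := by positivity
  have hν : (if κ.2 then -(n : ℝ) else n) ≠ 0 := by split_ifs <;> simpa using hn'
  have hsq : (if κ.2 then -(n : ℝ) else n) ^ 2 = (n : ℝ) ^ 2 := by split_ifs <;> ring
  rw [setIntegral_congr_fun (isOpen_openCell n κ).measurableSet
    fun z hz => gradDot_basisFun h1 h2 h1' h2' hκ hz, ← hsq, ← integral_gradDot_shape]
  exact setIntegral_preimage_affine _ isOpen_refTriangle.measurableSet hν _

theorem integrableOn_openCell {n : ℕ} {m m' : ℕ × ℕ} (h1 : m.1 < 3 * n)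
    (h2 : m.2 < 3 * n) (h1' : m'.1 < 3 * n) (h2' : m'.2 < 3 * n) {κ : (ℕ × ℕ) × Bool}
    (hκ : κ ∈ meshCells n) :
    IntegrableOn (gradDot (basisFun n m) (basisFun n m')) (openCell n κ) := by
  have hc : Continuous fun z => (n : ℝ) ^ 2 *
      gradDot (shape (localNode κ m)) (shape (localNode κ m')) (cellMap n κ z) :=
    continuous_const.mul ((continuous_gradDot_shape _ _).comp (continuous_cellMap n κ))
  refine IntegrableOn.congr_fun ?_ (fun z hz => (gradDot_basisFun h1 h2 h1' h2' hκ hz).symm)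
    (isOpen_openCell n κ).measurableSet
  refine (hc.continuousOn.integrableOn_compact (isCompact_Icc.prod isCompact_Icc)).mono_set
    ((openCell_subset_unitSquare hκ).trans (prod_mono (Ioo_subset_Icc_self (a := 0) (b := 1))
      (Ioo_subset_Icc_self (a := 0) (b := 1))))

/-- The stiffness matrix is assembled from the stiffness matrix of the reference triangle. -/
theorem integral_gradDot_basisFun {n : ℕ} (hn : 1 ≤ n) {m m' : ℕ × ℕ} (h1 : m.1 < 3 * n)
    (h2 : m.2 < 3 * n) (h1' : m'.1 < 3 * n) (h2' : m'.2 < 3 * n) :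
    ∫ z in unitSquare, gradDot (basisFun n m) (basisFun n m') z =
      ∑ κ ∈ meshCells n, (localStiffness (localNode κ m) (localNode κ m') : ℝ) / 80 := by
  rw [setIntegral_congr_set (unitSquare_ae_eq hn), integral_biUnion_finset]
  · exact Finset.sum_congr rfl fun κ hκ => integral_openCell hn h1 h2 h1' h2' hκ
  · exact fun κ _ => (isOpen_openCell n κ).measurableSet
  · exact fun κ _ κ' _ h => disjoint_openCell h
  · exact fun κ hκ => integrableOn_openCell h1 h2 h1' h2' hκ

end Mesh

/-! ### The assembled stiffness matrix -/

section Assembly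

/-- Position of a node of the grid: its cell and its number inside the cell. -/
def nodeBlock {n : ℕ} (i : Fin (3 * n - 1) × Fin (3 * n - 1)) : (ℤ × ℤ) × Fin 9 :=
  ((((i.1 : ℕ) / 3 : ℕ), ((i.2 : ℕ) / 3 : ℕ)),
    ⟨(i.1 : ℕ) % 3 + 3 * ((i.2 : ℕ) % 3), by omega⟩)

theorem nodeBlock_injective (n : ℕ) : Function.Injective (nodeBlock (n := n)) := by
  rintro ⟨⟨i₁, h₁⟩, i₂, h₂⟩ ⟨⟨j₁, h₁'⟩, j₂, h₂'⟩ h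
  simp only [nodeBlock, Prod.mk.injEq, Fin.mk.injEq] at h ⊢
  omega

/-- The stiffness of two nodes, multiplied by `80`: the first node has number `a` in the cell `0`,
the second one has number `b` in the cell `-d`. -/
def assembled (d : ℤ × ℤ) : Matrix (Fin 9) (Fin 9) ℤ :=
  Matrix.of fun a b => ∑ κ ∈ ({0, 1} ×ˢ {0, 1} : Finset (ℤ × ℤ)),
    (localStiffness ((b : ℕ) % 3 + 1 - 3 * d.1 - 3 * κ.1, (b : ℕ) / 3 + 1 - 3 * d.2 - 3 * κ.2)
      ((a : ℕ) % 3 + 1 - 3 * κ.1, (a : ℕ) / 3 + 1 - 3 * κ.2) +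
    localStiffness (3 - ((b : ℕ) % 3 + 1 - 3 * d.1 - 3 * κ.1),
        3 - ((b : ℕ) / 3 + 1 - 3 * d.2 - 3 * κ.2))
      (3 - ((a : ℕ) % 3 + 1 - 3 * κ.1), 3 - ((a : ℕ) / 3 + 1 - 3 * κ.2)))

theorem localStiffness_eq_zero_left {p q : ℤ × ℤ} (hp : ¬ (0 ≤ p.1 ∧ 0 ≤ p.2 ∧ p.1 + p.2 ≤ 3)) :
    localStiffness p q = 0 := if_neg fun h => hp h.1

theorem localStiffness_eq_zero_right {p q : ℤ × ℤ} (hq : ¬ (0 ≤ q.1 ∧ 0 ≤ q.2 ∧ q.1 + q.2 ≤ 3)) :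
    localStiffness p q = 0 := if_neg fun h => hq h.2

/-- The point where finite elements meet the symbol. Nine frequencies are computed; for any other
`d` the second node lies on none of the four squares of the sum. -/
theorem assembled_eq_coeffP3 (d : ℤ × ℤ) : assembled d = coeffP3 d := by
  by_cases hd : d ∈ freqP3
  · have h : ∀ d ∈ freqP3, assembled d = coeffP3 d := by decide +kernel
    exact h d hd
  · rw [coeffP3_eq_zero hd]
    rw [mem_freqP3] at hd
    ext a b
    simp only [assembled, Matrix.of_apply, Matrix.zero_apply]
    refine Finset.sum_eq_zero fun κ hκ => ?_
    simp only [Finset.mem_product, Finset.mem_insert, Finset.mem_singleton] at hκ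
    have ha := a.2
    have hb := b.2
    rw [localStiffness_eq_zero_left, localStiffness_eq_zero_left, add_zero] <;>
    · simp only
      omega

/-- The contribution of the square `c` of the mesh to the stiffness of two nodes. -/
theorem sum_localStiffness_square (c : ℕ × ℕ) (m m' : ℕ × ℕ) :
    ∑ σ : Bool, localStiffness (localNode (c, σ) m) (localNode (c, σ) m') =
      localStiffness ((m.1 : ℤ) - 3 * c.1, (m.2 : ℤ) - 3 * c.2)
        ((m'.1 : ℤ) - 3 * c.1, (m'.2 : ℤ) - 3 * c.2) +
      localStiffness (3 - ((m.1 : ℤ) - 3 * c.1), 3 - ((m.2 : ℤ) - 3 * c.2))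
        (3 - ((m'.1 : ℤ) - 3 * c.1), 3 - ((m'.2 : ℤ) - 3 * c.2)) := by
  rw [Fintype.sum_bool, add_comm]
  rfl

/-- The index `i` stands for the grid coordinate `i + 1`, so inside its cell a node has coordinates
`1`, `2` or `3`, and only the squares `i / 3` and `i / 3 + 1` in each direction can contain it. If
one of these falls outside the mesh, the node does not touch it, being internal; thus the boundary
leaves the entries unchanged. -/
theorem sum_meshCells_localStiffness {n : ℕ} (i j : Fin (3 * n - 1) × Fin (3 * n - 1)) :
    ∑ κ ∈ meshCells n, localStiffness (localNode κ (internalNode n j))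
        (localNode κ (internalNode n i)) =
      coeffP3 ((nodeBlock i).1 - (nodeBlock j).1) (nodeBlock i).2 (nodeBlock j).2 := by
  obtain ⟨⟨i₁, hi₁⟩, i₂, hi₂⟩ := i
  obtain ⟨⟨j₁, hj₁⟩, j₂, hj₂⟩ := j
  rw [meshCells, Finset.sum_product, ← assembled_eq_coeffP3, assembled, Matrix.of_apply]
  simp only [sum_localStiffness_square, internalNode]
  -- Translation of the cell of the first node to the origin, as in `assembled`.
  let e : ℕ × ℕ → ℤ × ℤ := fun c => ((c.1 : ℤ) - (i₁ / 3 : ℕ), (c.2 : ℤ) - (i₂ / 3 : ℕ))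
  have he : Function.Injective e := by
    rintro ⟨a, b⟩ ⟨a', b'⟩ h
    simp only [e, Prod.mk.injEq] at h ⊢
    omega
  rw [← Finset.sum_subset (s₁ := Finset.range n ×ˢ Finset.range n ∩
      {i₁ / 3, i₁ / 3 + 1} ×ˢ {i₂ / 3, i₂ / 3 + 1}) Finset.inter_subset_left]
  · have himg : ({0, 1} ×ˢ {0, 1} : Finset (ℤ × ℤ)) =
        ({i₁ / 3, i₁ / 3 + 1} ×ˢ {i₂ / 3, i₂ / 3 + 1} : Finset (ℕ × ℕ)).image e := by
      ext ⟨a, b⟩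
      simp only [Finset.mem_product, Finset.mem_insert, Finset.mem_singleton, Finset.mem_image,
        Prod.exists, e, Prod.mk.injEq]
      constructor
      · intro h
        exact ⟨(a + (i₁ / 3 : ℕ)).toNat, (b + (i₂ / 3 : ℕ)).toNat, by omega⟩
      · rintro ⟨a', b', h⟩
        omega
    rw [himg, Finset.sum_image he.injOn]
    rw [Finset.sum_subset (Finset.inter_subset_right
      (s₁ := Finset.range n ×ˢ Finset.range n))]
    · refine Finset.sum_congr rfl fun c _ => ?_
      simp only [nodeBlock, e, Prod.fst_sub, Prod.snd_sub]
      congr 2 <;> simp only [Prod.mk.injEq] <;> push_cast <;> omega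
    · intro c hc hc'
      simp only [Finset.mem_product, Finset.mem_insert, Finset.mem_singleton, Finset.mem_inter,
        Finset.mem_range] at hc hc'
      rw [localStiffness_eq_zero_right, localStiffness_eq_zero_right, add_zero] <;>
      · simp only
        push_cast
        omega
  · intro c hc hc'
    simp only [Finset.mem_product, Finset.mem_insert, Finset.mem_singleton, Finset.mem_inter,
      Finset.mem_range] at hc hc'
    rw [localStiffness_eq_zero_right, localStiffness_eq_zero_right, add_zero] <;>
    · simp only
      push_cast
      omega

/-- The stiffness matrix is a compression of the Laurent operator with the symbol `symbolP3`. -/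
theorem stiffness_eq_laurentCompression (n : ℕ) :
    (stiffness (fun _ => 1) n).map (fun x : ℝ => (x : ℂ)) =
      laurentCompression fourierP3 (nodeBlock (n := n)) := by
  ext i j
  have hi₁ := i.1.2
  have hi₂ := i.2.2
  have hj₁ := j.1.2
  have hj₂ := j.2.2
  simp only [stiffness, Matrix.map_apply, Matrix.of_apply, one_mul, laurentCompression, fourierP3]
  rw [integral_gradDot_basisFun (by omega) (by simp only [internalNode]; omega)
    (by simp only [internalNode]; omega) (by simp only [internalNode]; omega)
    (by simp only [internalNode]; omega), ← sum_meshCells_localStiffness, ← Finset.sum_div]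
  push_cast
  rfl

/-- Position of an index of the Toeplitz matrix. -/
def toeplitzBlock {n r : ℕ} (i : (Fin n × Fin n) × Fin r) : (ℤ × ℤ) × Fin r :=
  (((i.1.1 : ℕ), (i.1.2 : ℕ)), i.2)

theorem toeplitzBlock_injective (n r : ℕ) :
    Function.Injective (toeplitzBlock (n := n) (r := r)) := by
  rintro ⟨⟨⟨i₁, h₁⟩, i₂, h₂⟩, a⟩ ⟨⟨⟨j₁, h₁'⟩, j₂, h₂'⟩, b⟩ h
  simpa [toeplitzBlock] using h

theorem toeplitz_trigSymbol {r : ℕ} {F : ℤ × ℤ → Matrix (Fin r) (Fin r) ℂ} {S : Finset (ℤ × ℤ)}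
    (hF : ∀ k ∉ S, F k = 0) (n : ℕ) :
    toeplitz (fun θ₁ θ₂ => trigSymbol F S (θ₁, θ₂)) n n =
      laurentCompression F (toeplitzBlock (n := n)) := by
  ext i j
  simp only [toeplitz, Matrix.of_apply, fourierCoeff_trigSymbol hF]
  rfl

end Assembly

/-! ### The number of indices near the boundary -/

section Boundary

theorem card_boundary_pair_le {N B : ℕ} (P : Fin N → Prop) [DecidablePred P]
    (h : (Finset.univ.filter P).card ≤ B) :
    (Finset.univ.filter fun i : Fin N × Fin N => P i.1 ∨ P i.2).card ≤ 2 * B * N := by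
  have hsub : (Finset.univ.filter fun i : Fin N × Fin N => P i.1 ∨ P i.2) ⊆
      Finset.univ.filter P ×ˢ Finset.univ ∪ Finset.univ ×ˢ Finset.univ.filter P := by
    intro i hi
    simpa using hi
  refine (Finset.card_le_card hsub).trans ((Finset.card_union_le _ _).trans ?_)
  rw [Finset.card_product, Finset.card_product, Finset.card_univ, Fintype.card_fin]
  nlinarith

theorem card_near_ends_le (N s t : ℕ) :
    (Finset.univ.filter fun i : Fin N => (i : ℕ) < s ∨ N ≤ (i : ℕ) + t).card ≤ s + t := by
  have hsub : (Finset.univ.filter fun i : Fin N => (i : ℕ) < s ∨ N ≤ (i : ℕ) + t).image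
      (fun i : Fin N => (i : ℕ)) ⊆ Finset.range s ∪ Finset.Ico (N - t) N := by
    intro k hk
    obtain ⟨i, hi, rfl⟩ := Finset.mem_image.1 hk
    have := (Finset.mem_filter.1 hi).2
    have := i.2
    simp only [Finset.mem_union, Finset.mem_range, Finset.mem_Ico]
    omega
  rw [← Finset.card_image_of_injective _ Fin.val_injective]
  refine (Finset.card_le_card hsub).trans ((Finset.card_union_le _ _).trans ?_)
  simp only [Finset.card_range, Nat.card_Ico]
  omega

/-- A sequence that grows at most linearly is negligible with respect to one that grows at least
quadratically. -/
theorem isLittleO_of_le_linear_of_sq_le {a d : ℕ → ℕ} {C : ℕ} (ha : ∀ n, a n ≤ C * n)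
    (hd : ∀ n, n ^ 2 ≤ d n) : (fun n => (a n : ℝ)) =o[atTop] fun n => (d n : ℝ) := by
  have h1 : (fun n => (a n : ℝ)) =O[atTop] fun n : ℕ => (n : ℝ) ^ 1 :=
    IsBigO.of_bound C (Eventually.of_forall fun n => by
      have : (a n : ℝ) ≤ C * n := by exact_mod_cast ha n
      simpa using this)
  have h2 : (fun n : ℕ => (n : ℝ) ^ 1) =o[atTop] fun n : ℕ => (n : ℝ) ^ 2 :=
    (isLittleO_pow_pow_atTop_of_lt (𝕜 := ℝ) one_lt_two).comp_tendsto tendsto_natCast_atTop_atTop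
  have h3 : (fun n : ℕ => (n : ℝ) ^ 2) =O[atTop] fun n => (d n : ℝ) :=
    IsBigO.of_bound 1 (Eventually.of_forall fun n => by
      have : (n : ℝ) ^ 2 ≤ d n := by exact_mod_cast hd n
      simpa using this)
  exact (h1.trans_isLittleO h2).trans_isBigO h3

end Boundary

/-! ### Clustering -/

section Clustering

theorem isHermitian_trigSymbol_fourierP3 (θ : ℝ × ℝ) :
    (trigSymbol fourierP3 freqP3 θ).IsHermitian :=
  trigSymbol_isHermitian (fun k hk => by
    rw [mem_freqP3] at hk ⊢
    simp only [Prod.fst_neg, Prod.snd_neg]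
    omega) fourierP3_neg θ

theorem symbolP3_eq : symbolP3 = fun θ₁ θ₂ => trigSymbol fourierP3 freqP3 (θ₁, θ₂) :=
  funext₂ symbolP3_eq_trigSymbol

/-- Compressions to index sets of quadratic size with a boundary of linear size are clustered at
the range of the symbol. -/
theorem isWeaklyClustered_laurentCompression {r : ℕ} [NeZero r]
    {F : ℤ × ℤ → Matrix (Fin r) (Fin r) ℂ} {S : Finset (ℤ × ℤ)} (hF : ∀ k ∉ S, F k = 0)
    (hH : ∀ θ, (trigSymbol F S θ).IsHermitian) {ι : ℕ → Type} [∀ n, Fintype (ι n)]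
    [∀ n, DecidableEq (ι n)] {g : ∀ n, ι n → (ℤ × ℤ) × Fin r}
    (hg : ∀ n, Function.Injective (g n)) (hM : ∀ n, (laurentCompression F (g n)).IsHermitian)
    (hmono : StrictMono fun n => Fintype.card (ι n)) (hsq : ∀ n, n ^ 2 ≤ Fintype.card (ι n))
    (J : ∀ n, Finset (ι n))
    (hJ : ∀ n, ∀ j ∈ J n, ∀ d ∈ S, ∀ a, ∃ i, g n i = ((g n j).1 + d, a)) {C : ℕ}
    (hC : ∀ n, (J n)ᶜ.card ≤ C * n) :
    IsWeaklyClustered (fun n => laurentCompression F (g n))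
      (symbolRange fun θ₁ θ₂ => trigSymbol F S (θ₁, θ₂)) where
  nonempty := symbolRange_nonempty hH
  isClosed := isClosed_symbolRange (continuous_trigSymbol F S)
  size_strictMono := hmono
  outliers_isLittleO := by
    intro ε hε
    obtain ⟨K, hK⟩ := exists_numOutliers_laurentCompression_le hF hH hε
    refine isLittleO_of_le_linear_of_sq_le (C := K * C) (fun n => ?_) hsq
    refine (hK (ι n) (g n) (hg n) (hM n) (J n) (hJ n)).trans ?_
    rw [mul_assoc]
    exact Nat.mul_le_mul_left K (hC n)

theorem isWeaklyClustered_toeplitz_symbolP3 :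
    IsWeaklyClustered (fun n => toeplitz symbolP3 n n) (symbolRange symbolP3) := by
  rw [symbolP3_eq]
  simp only [toeplitz_trigSymbol fun k => fourierP3_eq_zero]
  refine isWeaklyClustered_laurentCompression (fun k => fourierP3_eq_zero)
    isHermitian_trigSymbol_fourierP3 (fun n => toeplitzBlock_injective n 9)
    (fun n => laurentCompression_isHermitian fourierP3_neg _) ?_ ?_
    -- All frequencies are at most `1` in absolute value, so removing the outermost layer of blocks
    -- suffices: at most `2 * 2 * n` blocks of size `9`, whence `36`.
    (fun n => Finset.univ.filter fun i => ¬ (((i.1.1 : ℕ) < 1 ∨ n ≤ (i.1.1 : ℕ) + 1) ∨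
      ((i.1.2 : ℕ) < 1 ∨ n ≤ (i.1.2 : ℕ) + 1))) ?_ (C := 36) ?_
  · refine strictMono_nat_of_lt_succ fun n => ?_
    simp only [Fintype.card_prod, Fintype.card_fin]
    nlinarith
  · intro n
    simp only [Fintype.card_prod, Fintype.card_fin]
    nlinarith
  · rintro n ⟨⟨⟨j₁, h₁⟩, j₂, h₂⟩, b⟩ hj ⟨d₁, d₂⟩ hd a
    simp only [Finset.mem_filter, Finset.mem_univ, true_and, mem_freqP3] at hj hd
    refine ⟨((⟨(j₁ + d₁).toNat, by omega⟩, ⟨(j₂ + d₂).toNat, by omega⟩), a), ?_⟩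
    simp only [toeplitzBlock, Prod.mk_add_mk, Prod.mk.injEq, and_true]
    omega
  · intro n
    have h := card_boundary_pair_le _ (card_near_ends_le n 1 1)
    have e : (Finset.univ.filter fun i : (Fin n × Fin n) × Fin 9 =>
        ¬ (((i.1.1 : ℕ) < 1 ∨ n ≤ (i.1.1 : ℕ) + 1) ∨
        ((i.1.2 : ℕ) < 1 ∨ n ≤ (i.1.2 : ℕ) + 1)))ᶜ =
        (Finset.univ.filter fun i : Fin n × Fin n => ((i.1 : ℕ) < 1 ∨ n ≤ (i.1 : ℕ) + 1) ∨
        ((i.2 : ℕ) < 1 ∨ n ≤ (i.2 : ℕ) + 1)) ×ˢ Finset.univ := by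
      ext i
      simp only [Finset.mem_compl, Finset.mem_filter, Finset.mem_univ, true_and, not_not,
        Finset.mem_product, and_true]
    rw [e, Finset.card_product, Finset.card_univ, Fintype.card_fin]
    omega

theorem isWeaklyClustered_stiffness :
    IsWeaklyClustered (fun n => (stiffness (fun _ => 1) n).map (fun x : ℝ => (x : ℂ)))
      (symbolRange symbolP3) := by
  rw [symbolP3_eq]
  simp only [stiffness_eq_laurentCompression]
  refine isWeaklyClustered_laurentCompression (fun k => fourierP3_eq_zero)
    isHermitian_trigSymbol_fourierP3 nodeBlock_injective
    (fun n => laurentCompression_isHermitian fourierP3_neg _) ?_ ?_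
    -- The last cell `n - 1` is incomplete, as the index `3 * n - 1` is missing. All neighbouring
    -- cells are complete when `1 ≤ i / 3 ≤ n - 3`, that is, `3 ≤ i ≤ 3 * n - 7`. The count `2 * (3
    -- + 5) * (3 * n - 1)` is at most `48 * n`.
    (fun n => Finset.univ.filter fun i =>
      ¬ (((i.1 : ℕ) < 3 ∨ 3 * n - 1 ≤ (i.1 : ℕ) + 5) ∨
        ((i.2 : ℕ) < 3 ∨ 3 * n - 1 ≤ (i.2 : ℕ) + 5))) ?_ (C := 48) ?_
  · refine strictMono_nat_of_lt_succ fun n => ?_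
    simp only [Fintype.card_prod, Fintype.card_fin]
    exact Nat.mul_lt_mul'' (by omega) (by omega)
  · intro n
    simp only [Fintype.card_prod, Fintype.card_fin, sq]
    exact Nat.mul_le_mul (by omega) (by omega)
  · rintro n ⟨⟨j₁, h₁⟩, j₂, h₂⟩ hj ⟨d₁, d₂⟩ hd ⟨a, ha⟩
    simp only [Finset.mem_filter, Finset.mem_univ, true_and, mem_freqP3] at hj hd
    -- Inverse of `nodeBlock`: three times the shifted cell plus the base-3 digits of `a`. The
    -- shifted cell is nonnegative, so `toNat` loses nothing.
    refine ⟨(⟨(3 * (((j₁ / 3 : ℕ) : ℤ) + d₁)).toNat + a % 3, by omega⟩,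
      ⟨(3 * (((j₂ / 3 : ℕ) : ℤ) + d₂)).toNat + a / 3, by omega⟩), ?_⟩
    simp only [nodeBlock, Prod.mk_add_mk, Prod.mk.injEq, Fin.mk.injEq]
    omega
  · intro n
    have h := card_boundary_pair_le _ (card_near_ends_le (3 * n - 1) 3 5)
    rw [Finset.compl_filter]
    simp only [not_not]
    omega

end Clustering

end P3FEM

theorem corollary3p3p2 :
    P3FEM.IsWeaklyClustered (fun n => P3FEM.toeplitz P3FEM.symbolP3 n n)
        (P3FEM.symbolRange P3FEM.symbolP3) ∧
    P3FEM.IsWeaklyClustered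
        (fun n => (P3FEM.stiffness (fun _ => 1) n).map (fun x : ℝ => (x : ℂ)))
        (P3FEM.symbolRange P3FEM.symbolP3) ∧
    ∀ n : ℕ,
      spectrum ℂ (P3FEM.toeplitz P3FEM.symbolP3 n n) ⊆
        convexHull ℝ (P3FEM.symbolRange P3FEM.symbolP3) ∧
      spectrum ℂ ((P3FEM.stiffness (fun _ => 1) n).map (fun x : ℝ => (x : ℂ))) ⊆
        convexHull ℝ (P3FEM.symbolRange P3FEM.symbolP3) := by
  refine ⟨P3FEM.isWeaklyClustered_toeplitz_symbolP3, P3FEM.isWeaklyClustered_stiffness,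
    fun n => ⟨?_, ?_⟩⟩
  · rw [P3FEM.symbolP3_eq, P3FEM.toeplitz_trigSymbol fun k => P3FEM.fourierP3_eq_zero]
    exact P3FEM.spectrum_laurentCompression_subset (fun k => P3FEM.fourierP3_eq_zero)
      P3FEM.isHermitian_trigSymbol_fourierP3 (P3FEM.toeplitzBlock_injective n 9)
      (P3FEM.laurentCompression_isHermitian P3FEM.fourierP3_neg _)
  · rw [P3FEM.symbolP3_eq, P3FEM.stiffness_eq_laurentCompression]
    exact P3FEM.spectrum_laurentCompression_subset (fun k => P3FEM.fourierP3_eq_zero)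
      P3FEM.isHermitian_trigSymbol_fourierP3 (P3FEM.nodeBlock_injective n)
      (P3FEM.laurentCompression_isHermitian P3FEM.fourierP3_neg _)
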